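/- **Theorem (analytic reconstruction operator).** Let $X$ be a real separable Hilbert space and $A$ a skew-adjoint (densely defined, $A^*=-A$) operator on $X$ such that $A^*A=-A^2$ has a compact resolvent. For $r\in\mathbb{R}$ let $X^r=D((A^*A)^{r/2})$ with norm $\|u\|_{X^r}=\|(1+A^*A)^{r/2}u\|_X$ (for $r<0$, the completion of $X$ in this norm), let $e^{tA}$ be the unitary group generated by $A$, acting on every $X^r$, and for $n\in\mathbb{N}$ let $\mathcal{P}_n=\mathbf{1}_{[0,n]}((A^*A)^{1/2})$ and $\mathcal{Q}_n=I-\mathcal{P}_n$; the spaces $\mathcal{P}_nX^r$, $\mathcal{Q}_nX^r$ carry the norm of $X^r$. For a real Hilbert space $Y$ let $Y_{\mathbb{C}}=\{y_1+iy_2\}$ be its complexification with $\|y_1+iy_2\|^2=\|y_1\|^2+\|y_2\|^2$, and for $T>0$ put $$\mathcal{B}_M(Y)=\{U\in C^0([0,T],Y):\ \|U(t)\|_Y\le M\ \forall t\},$$ $$\mathcal{B}_{M,\delta}(Y)=\{U\in C^0([0,T],Y_{\mathbb{C}}):\ \|\mathrm{Re}\,U(t)\|_Y\le M,\ \|\mathrm{Im}\,U(t)\|_Y\le\delta\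 \forall t\},$$ with the supremum norms. A map is called holomorphic on a closed subset $D$ of a complex Banach space if it is complex (Fréchet) differentiable in the interior of $D$ and continuous on $D$. Fix $T>0$, $\sigma\in[0,1]$, $\varepsilon>0$, $R_0>0$, $R_1>0$, and assume: 1. $\mathbf{C}\in\mathcal{L}(X^\sigma)$ restricts to an element of $\mathcal{L}(X^{\sigma+\varepsilon})$ and, for $r=\sigma$ and for $r=\sigma+\varepsilon$, there is $\kappa>0$ with $\|W_0\|_{X^r}^2\le\kappa^2\int_0^T\|\mathbf{C}e^{tA}W_0\|_{X^r}^2\,dt$ for all $W_0\in X^r$. 2. $F$ maps the ball $\{\|u\|_{X^\sigma}\le 4R_0\}$ to $X^{\sigma+\varepsilon}$, and there is $c>0$ with $\|F(u)\|_{X^{\sigma+\varepsilon}}\le c$ and $\|F(u)-F(v)\|_{X^{\sigma+\varepsilon}}\le c\|u-v\|_{X^\sigma}$ for all $u,v$ in this ball. 3. For some $s>0$ the commutator $[(A^*A)^s,\mathbf{C}]$, which maps $X^{\sigma+2s}$ to $X^{\sigma-2s}$, belongs to $\mathcal{L}(X^{\sigma+2s},X^{\sigma+\varepsilon})$. Then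 there exist $n\in\mathbb{N}$ and a Lipschitz map $$\mathcal{R}:\ \mathcal{B}_{R_0}(\mathcal{P}_nX^\sigma)\times\mathcal{B}_{R_0}(X^\sigma)\times\mathcal{B}_{R_1}(X^{\sigma+\varepsilon})\to\mathcal{B}_{R_0}(\mathcal{Q}_nX^\sigma)$$ such that, for all $U\in\mathcal{B}_{R_0}(X^\sigma)$, $H_1\in\mathcal{B}_{R_0}(X^\sigma)$, $H_2\in\mathcal{B}_{R_1}(X^{\sigma+\varepsilon})$ satisfying $$\partial_tU=AU+F(U+H_1)+H_2,\qquad \mathbf{C}U(t)=0\qquad\text{on }[0,T]\tag{$*$}$$ (the first equation in the sense of Duhamel's formula $U(t)=e^{tA}U(0)+\int_0^te^{(t-s)A}[F(U(s)+H_1(s))+H_2(s)]\,ds$), one has $\mathcal{Q}_nU=\mathcal{R}(\mathcal{P}_nU,H_1,H_2)$. Moreover, suppose in addition that for some $\delta>0$ the map $F$ extends to a holomorphic map from $\{u\in X^\sigma_{\mathbb{C}}:\|\mathrm{Re}\,u\|_{X^\sigma}\le4R_0,\ \|\mathrm{Im}\,u\|_{X^\sigma}\le2\delta\}$ to $X^{\sigma+\varepsilon}_{\mathbb{C}}$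 that is bounded and Lipschitz there. Then there exist $\eta,\eta_1>0$ such that, for every $U\in\mathcal{B}_{R_0}(X^\sigma)$ that satisfies $(*)$ for some $H_1\in\mathcal{B}_{R_0}(X^\sigma)$ and $H_2\in\mathcal{B}_{R_1}(X^{\sigma+\varepsilon})$, the map $\mathcal{R}$ extends holomorphically to a map $$\big(\mathcal{P}_nU+\mathcal{B}_{\eta,\eta}(\mathcal{P}_nX^\sigma)\big)\times\mathcal{B}_{R_0,\eta}(X^\sigma)\times\mathcal{B}_{R_1,R_1}(X^{\sigma+\varepsilon})\to\mathcal{B}_{R_0,\eta_1}(\mathcal{Q}_nX^\sigma),$$ where "extends" means that the two maps agree at the real points at which both are defined. -/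

import Mathlib

open scoped NNReal InnerProductSpace

/-! ## The skew-adjoint operator -/

section Operator

variable {X : Type*} [NormedAddCommGroup X] [InnerProductSpace ℝ X] [CompleteSpace X]

/-- A densely defined unbounded operator `A` on a real Hilbert space with `A* = -A`. -/
structure IsSkewAdjoint (A : X →ₗ.[ℝ] X) : Prop where
  dense : Dense (A.domain : Set X)
  adjoint_eq : A.adjoint = -A

/-- The operator `A*A`, on its natural domain `{x ∈ D(A) | A x ∈ D(A*)}`. -/
noncomputable def adjointMulSelf (A : X →ₗ.[ℝ] X) : X →ₗ.[ℝ] X where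
  domain :=
    { carrier := {x | ∃ h : x ∈ A.domain, A ⟨x, h⟩ ∈ A.adjoint.domain}
      add_mem' := by
        rintro x y ⟨hx, hx'⟩ ⟨hy, hy'⟩
        refine ⟨add_mem hx hy, ?_⟩
        have := A.map_add ⟨x, hx⟩ ⟨y, hy⟩
        rw [AddMemClass.mk_add_mk] at this
        rw [this]
        exact add_mem hx' hy'
      zero_mem' := ⟨zero_mem _, by
        have h : A ⟨0, zero_mem _⟩ = 0 := A.map_zero
        rw [h]
        exact zero_mem _⟩
      smul_mem' := by
        rintro c x ⟨hx, hx'⟩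
        refine ⟨Submodule.smul_mem _ c hx, ?_⟩
        have := A.map_smul c ⟨x, hx⟩
        rw [SetLike.mk_smul_mk] at this
        rw [this]
        exact Submodule.smul_mem _ c hx' }
  toFun :=
    { toFun := fun x => A.adjoint ⟨A ⟨x.1, x.2.fst⟩, x.2.snd⟩
      map_add' := by
        intro x y
        rw [← LinearPMap.map_add]
        congr 1
        exact Subtype.ext (A.map_add ⟨x.1, x.2.fst⟩ ⟨y.1, y.2.fst⟩)
      map_smul' := by
        intro c x
        rw [RingHom.id_apply, ← LinearPMap.map_smul]
        congr 1
        exact Subtype.ext (A.map_smul c ⟨x.1, x.2.fst⟩) }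

/-- `B` has a compact resolvent: for some `μ`, the operator `B - μ` is a bijection from `D(B)` onto
the whole space, and its inverse is a (bounded) compact operator. -/
def HasCompactResolvent (B : X →ₗ.[ℝ] X) : Prop :=
  ∃ (μ : ℝ) (K : X →L[ℝ] X), IsCompactOperator K ∧
    (∀ x : X, ∃ h : K x ∈ B.domain, B ⟨K x, h⟩ - μ • K x = x) ∧
    ∀ y : B.domain, K (B y - μ • (y : X)) = y

/-- The eigenspace of `(A*A)^(1/2)` for the eigenvalue `ω ≥ 0`, that is, the eigenspace of `A*A`
for the eigenvalue `ω²`. -/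
noncomputable def modulusEigenspace (A : X →ₗ.[ℝ] X) (ω : ℝ≥0) : Submodule ℝ X where
  carrier := {x | ∃ h : x ∈ (adjointMulSelf A).domain,
    adjointMulSelf A ⟨x, h⟩ = ((ω : ℝ) ^ 2) • x}
  add_mem' := by
    rintro x y ⟨hx, hx'⟩ ⟨hy, hy'⟩
    refine ⟨add_mem hx hy, ?_⟩
    have := (adjointMulSelf A).map_add ⟨x, hx⟩ ⟨y, hy⟩
    rw [AddMemClass.mk_add_mk] at this
    rw [this, hx', hy', smul_add]
  zero_mem' := ⟨zero_mem _, by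
    have h : (adjointMulSelf A) ⟨0, zero_mem _⟩ = 0 := (adjointMulSelf A).map_zero
    rw [h, smul_zero]⟩
  smul_mem' := by
    rintro c x ⟨hx, hx'⟩
    refine ⟨Submodule.smul_mem _ c hx, ?_⟩
    have := (adjointMulSelf A).map_smul c ⟨x, hx⟩
    rw [SetLike.mk_smul_mk] at this
    rw [this, hx', smul_comm]

theorem mem_modulusEigenspace {A : X →ₗ.[ℝ] X} {ω : ℝ≥0} {x : X} :
    x ∈ modulusEigenspace A ω ↔ ∃ h : x ∈ (adjointMulSelf A).domain,
      adjointMulSelf A ⟨x, h⟩ = ((ω : ℝ) ^ 2) • x := Iff.rfl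

variable {A : X →ₗ.[ℝ] X}

theorem IsSkewAdjoint.mem_adjoint_iff (hA : IsSkewAdjoint A) {x : X} :
    x ∈ A.adjoint.domain ↔ x ∈ A.domain := by
  rw [hA.adjoint_eq, LinearPMap.neg_domain]

theorem IsSkewAdjoint.adjoint_apply (hA : IsSkewAdjoint A) {x : X}
    (h : x ∈ A.adjoint.domain) (h' : x ∈ A.domain) : A.adjoint ⟨x, h⟩ = -A ⟨x, h'⟩ := by
  have key : ∀ (B : X →ₗ.[ℝ] X), B = -A → ∀ (hB : x ∈ B.domain), B ⟨x, hB⟩ = -A ⟨x, h'⟩ := by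
    rintro B rfl hB
    rfl
  exact key _ hA.adjoint_eq h

theorem IsSkewAdjoint.inner_eq (hA : IsSkewAdjoint A) (x y : A.domain) :
    ⟪A x, (y : X)⟫_ℝ = -⟪(x : X), A y⟫_ℝ := by
  have h2 := hA.adjoint_apply (hA.mem_adjoint_iff.2 x.2) x.2
  have h3 := LinearPMap.adjoint_isFormalAdjoint hA.dense ⟨x, hA.mem_adjoint_iff.2 x.2⟩ y
  rw [h2, inner_neg_left] at h3
  have h4 : A ⟨(x : X), x.2⟩ = A x := rfl
  rw [h4] at h3
  linarith

/-- On the eigenspaces, `A` acts as a skew-symmetric operator with square `-ω²`. -/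
theorem IsSkewAdjoint.modulusEigenspace_spec (hA : IsSkewAdjoint A) {ω : ℝ≥0} {x : X}
    (hx : x ∈ modulusEigenspace A ω) :
    ∃ (h : x ∈ A.domain) (h' : A ⟨x, h⟩ ∈ A.domain),
      A ⟨A ⟨x, h⟩, h'⟩ = -(((ω : ℝ) ^ 2) • x) := by
  obtain ⟨⟨h, h'⟩, e⟩ := hx
  refine ⟨h, hA.mem_adjoint_iff.1 h', ?_⟩
  have e' : A.adjoint ⟨A ⟨x, h⟩, h'⟩ = ((ω : ℝ) ^ 2) • x := e
  rw [hA.adjoint_apply h' (hA.mem_adjoint_iff.1 h')] at e'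
  rw [← e', neg_neg]

theorem IsSkewAdjoint.mem_modulusEigenspace_of (hA : IsSkewAdjoint A) {ω : ℝ≥0} {x : X}
    (h : x ∈ A.domain) (h' : A ⟨x, h⟩ ∈ A.domain)
    (e : A ⟨A ⟨x, h⟩, h'⟩ = -(((ω : ℝ) ^ 2) • x)) : x ∈ modulusEigenspace A ω := by
  refine ⟨⟨h, hA.mem_adjoint_iff.2 h'⟩, ?_⟩
  change A.adjoint ⟨A ⟨x, h⟩, _⟩ = _
  rw [hA.adjoint_apply _ h', e, neg_neg]

/-- The restriction of `A` to an eigenspace of `A*A`, which it maps to itself. -/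
noncomputable def IsSkewAdjoint.onEigenspace (hA : IsSkewAdjoint A) (ω : ℝ≥0) :
    modulusEigenspace A ω →ₗ[ℝ] modulusEigenspace A ω where
  toFun x := ⟨A ⟨x, (hA.modulusEigenspace_spec x.2).fst⟩, by
    obtain ⟨h, h', e⟩ := hA.modulusEigenspace_spec x.2
    have e1 : A ⟨A ⟨A ⟨x, h⟩, h'⟩, by rw [e]; exact neg_mem (Submodule.smul_mem _ _ h)⟩
        = -(((ω : ℝ) ^ 2) • A ⟨x, h⟩) := by
      rw [← A.map_smul, ← A.map_neg]
      congr 1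
      exact Subtype.ext e
    exact hA.mem_modulusEigenspace_of h' _ e1⟩
  map_add' x y := Subtype.ext (A.map_add ⟨x, (hA.modulusEigenspace_spec x.2).fst⟩
    ⟨y, (hA.modulusEigenspace_spec y.2).fst⟩)
  map_smul' c x := Subtype.ext (A.map_smul c ⟨x, (hA.modulusEigenspace_spec x.2).fst⟩)

theorem IsSkewAdjoint.onEigenspace_sq (hA : IsSkewAdjoint A) (ω : ℝ≥0)
    (x : modulusEigenspace A ω) :
    hA.onEigenspace ω (hA.onEigenspace ω x) = -(((ω : ℝ) ^ 2) • x) := by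
  obtain ⟨h, h', e⟩ := hA.modulusEigenspace_spec x.2
  exact Subtype.ext e

theorem IsSkewAdjoint.inner_onEigenspace (hA : IsSkewAdjoint A) (ω : ℝ≥0)
    (x y : modulusEigenspace A ω) :
    ⟪hA.onEigenspace ω x, y⟫_ℝ = -⟪x, hA.onEigenspace ω y⟫_ℝ :=
  hA.inner_eq ⟨x, (hA.modulusEigenspace_spec x.2).fst⟩ ⟨y, (hA.modulusEigenspace_spec y.2).fst⟩

/-- The group `e^{tA}` on an eigenspace of `A*A` for the eigenvalue `ω²`: since there `A² = -ω²`,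
it is `cos(tω) + (sin(tω)/ω) A`, where `sin(tω)/ω = t sinc(tω)` is read as `t` for `ω = 0`. -/
noncomputable def IsSkewAdjoint.expOnEigenspace (hA : IsSkewAdjoint A) (t : ℝ) (ω : ℝ≥0) :
    modulusEigenspace A ω →ₗ[ℝ] modulusEigenspace A ω :=
  Real.cos (t * ω) • LinearMap.id + (t * Real.sinc (t * ω)) • hA.onEigenspace ω

theorem IsSkewAdjoint.norm_expOnEigenspace (hA : IsSkewAdjoint A) (t : ℝ) (ω : ℝ≥0)
    (x : modulusEigenspace A ω) : ‖hA.expOnEigenspace t ω x‖ = ‖x‖ := by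
  have h0 : ⟪x, hA.onEigenspace ω x⟫_ℝ = 0 := by
    have h := hA.inner_onEigenspace ω x x
    rw [real_inner_comm] at h
    linarith
  have h1 : ‖hA.onEigenspace ω x‖ ^ 2 = (ω : ℝ) ^ 2 * ‖x‖ ^ 2 := by
    rw [← real_inner_self_eq_norm_sq, hA.inner_onEigenspace, hA.onEigenspace_sq, inner_neg_right,
      inner_smul_right, real_inner_self_eq_norm_sq, neg_neg]
  have h2 : t * Real.sinc (t * ω) * ω = Real.sin (t * ω) := by
    by_cases h : t * (ω : ℝ) = 0
    · rw [h, Real.sinc_zero, mul_one, h, Real.sin_zero]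
    · rw [Real.sinc_of_ne_zero h, mul_right_comm, mul_div_cancel₀ _ h]
  have h3 : ‖hA.expOnEigenspace t ω x‖ ^ 2 = ‖x‖ ^ 2 := by
    simp only [IsSkewAdjoint.expOnEigenspace, LinearMap.add_apply, LinearMap.smul_apply,
      LinearMap.id_apply]
    rw [norm_add_sq_real, inner_smul_left, inner_smul_right, h0, norm_smul, norm_smul, mul_pow,
      mul_pow, h1, Real.norm_eq_abs, Real.norm_eq_abs, sq_abs, sq_abs]
    have h4 := Real.sin_sq_add_cos_sq (t * ω)
    rw [← h2] at h4
    linear_combination ‖x‖ ^ 2 * h4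
  exact (sq_eq_sq₀ (norm_nonneg _) (norm_nonneg _)).1 h3

theorem IsSkewAdjoint.adjointMulSelf_spec (hA : IsSkewAdjoint A) (x : (adjointMulSelf A).domain) :
    ∃ (h : (x : X) ∈ A.domain) (h' : A ⟨x, h⟩ ∈ A.domain),
      adjointMulSelf A x = -A ⟨A ⟨x, h⟩, h'⟩ := by
  obtain ⟨x, h, h'⟩ := x
  exact ⟨h, hA.mem_adjoint_iff.1 h', hA.adjoint_apply _ _⟩

theorem IsSkewAdjoint.inner_adjointMulSelf (hA : IsSkewAdjoint A)
    (x y : (adjointMulSelf A).domain) :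
    ⟪adjointMulSelf A x, (y : X)⟫_ℝ = ⟪A ⟨x, x.2.fst⟩, A ⟨y, y.2.fst⟩⟫_ℝ := by
  obtain ⟨h, h', e⟩ := hA.adjointMulSelf_spec x
  rw [e, inner_neg_left, hA.inner_eq ⟨_, h'⟩ ⟨y, y.2.fst⟩, neg_neg]

/-- Under the standing assumptions on `A`, the space `X` is the Hilbert sum of the eigenspaces, so
that vectors of `X` are the same as square summable families of components in the eigenspaces. -/
theorem IsSkewAdjoint.isHilbertSum (hA : IsSkewAdjoint A)
    (hK : HasCompactResolvent (adjointMulSelf A)) :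
    IsHilbertSum ℝ (fun ω => modulusEigenspace A ω)
      (fun ω => (modulusEigenspace A ω).subtypeₗᵢ) := by
  obtain ⟨μ, K, hKc, hK1, hK2⟩ := hK
  have hsymm : ∀ x y : (adjointMulSelf A).domain,
      ⟪adjointMulSelf A x, (y : X)⟫_ℝ = ⟪(x : X), adjointMulSelf A y⟫_ℝ := by
    intro x y
    rw [hA.inner_adjointMulSelf, ← real_inner_comm (x : X), hA.inner_adjointMulSelf,
      real_inner_comm]
  have hmem : ∀ ω x, x ∈ modulusEigenspace A ω →
      K ((((ω : ℝ) ^ 2) - μ) • x) = x := by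
    rintro ω x ⟨h, e⟩
    have := hK2 ⟨x, h⟩
    rw [e] at this
    rw [sub_smul]
    exact this
  have hmem' : ∀ (ν : ℝ) x, K x = ν • x → x ≠ 0 → ∃ ω, x ∈ modulusEigenspace A ω := by
    intro ν x hx hx0
    obtain ⟨h, e⟩ := hK1 x
    have hν : ν ≠ 0 := by
      rintro rfl
      apply hx0
      have h0 : K x = 0 := by rw [hx, zero_smul]
      have h1 : adjointMulSelf A ⟨K x, h⟩ = 0 := by
        have : (⟨K x, h⟩ : (adjointMulSelf A).domain) = 0 := Subtype.ext h0
        rw [this, LinearPMap.map_zero]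
      rw [h1, h0, smul_zero, sub_zero] at e
      exact e.symm
    have hxd : x ∈ (adjointMulSelf A).domain := by
      have : x = ν⁻¹ • K x := by rw [hx, smul_smul, inv_mul_cancel₀ hν, one_smul]
      rw [this]
      exact Submodule.smul_mem _ _ h
    have e2 : adjointMulSelf A ⟨x, hxd⟩ = (μ + ν⁻¹) • x := by
      have h1 : adjointMulSelf A ⟨K x, h⟩ = ν • adjointMulSelf A ⟨x, hxd⟩ := by
        rw [← LinearPMap.map_smul]
        congr 1
        exact Subtype.ext hx
      rw [h1, hx, sub_eq_iff_eq_add] at e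
      calc adjointMulSelf A ⟨x, hxd⟩ = ν⁻¹ • (ν • adjointMulSelf A ⟨x, hxd⟩) := by
            rw [smul_smul, inv_mul_cancel₀ hν, one_smul]
        _ = (μ + ν⁻¹) • x := by
            rw [e, smul_add, add_smul, smul_smul, smul_smul, add_comm]
            congr 2
            field_simp
    have h3 : 0 ≤ μ + ν⁻¹ := by
      have h4 := hA.inner_adjointMulSelf ⟨x, hxd⟩ ⟨x, hxd⟩
      rw [e2, inner_smul_left, real_inner_self_eq_norm_sq, real_inner_self_eq_norm_sq] at h4
      have h5 : 0 < ‖x‖ ^ 2 := by positivity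
      by_contra hneg
      push Not at hneg
      have : (μ + ν⁻¹) * ‖x‖ ^ 2 < 0 := mul_neg_of_neg_of_pos hneg h5
      have h6 : (starRingEnd ℝ) (μ + ν⁻¹) = μ + ν⁻¹ := rfl
      rw [h6] at h4
      have h7 := sq_nonneg ‖A ⟨x, hxd.fst⟩‖
      linarith
    refine ⟨⟨Real.sqrt (μ + ν⁻¹), Real.sqrt_nonneg _⟩, hxd, ?_⟩
    rw [e2]
    congr 1
    exact (Real.sq_sqrt h3).symm
  have hKsymm : (K : X →ₗ[ℝ] X).IsSymmetric := by
    intro x y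
    obtain ⟨hx, ex⟩ := hK1 x
    obtain ⟨hy, ey⟩ := hK1 y
    change ⟪K x, y⟫_ℝ = ⟪x, K y⟫_ℝ
    conv_lhs => rw [← ey]
    conv_rhs => rw [← ex]
    rw [inner_sub_right, inner_sub_left, inner_smul_left, inner_smul_right]
    have := hsymm ⟨K x, hx⟩ ⟨K y, hy⟩
    simp only at this
    rw [this]
    rfl
  have hclosed : ∀ ω, IsClosed (modulusEigenspace A ω : Set X) := by
    intro ω
    have : (modulusEigenspace A ω : Set X) = {x | K ((((ω : ℝ) ^ 2) - μ) • x) = x} := by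
      ext x
      refine ⟨hmem ω x, fun h => ?_⟩
      change K _ = x at h
      obtain ⟨h', e⟩ := hK1 ((((ω : ℝ) ^ 2) - μ) • x)
      have hx : x ∈ (adjointMulSelf A).domain := by
        rw [← h]
        exact h'
      have h1 : (⟨_, h'⟩ : (adjointMulSelf A).domain) = ⟨x, hx⟩ := Subtype.ext h
      rw [h1, h, sub_smul] at e
      exact ⟨hx, sub_left_injective e⟩
    rw [this]
    exact isClosed_eq (by fun_prop) continuous_id
  have : ∀ ω, CompleteSpace (modulusEigenspace A ω) := fun ω =>
    (hclosed ω).completeSpace_coe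
  refine IsHilbertSum.mkInternal (𝕜 := ℝ) (F := fun ω => modulusEigenspace A ω) ?_ ?_
  · rintro ω ω' hne ⟨x, hx, ex⟩ ⟨y, hy, ey⟩
    change ⟪x, y⟫_ℝ = 0
    have h := hsymm ⟨x, hx⟩ ⟨y, hy⟩
    rw [ex, ey, inner_smul_left, inner_smul_right] at h
    have h6 : (starRingEnd ℝ) ((ω : ℝ) ^ 2) = (ω : ℝ) ^ 2 := rfl
    rw [h6] at h
    by_contra h0
    have h7 := mul_right_cancel₀ h0 h
    exact hne (NNReal.eq ((sq_eq_sq₀ ω.2 ω'.2).1 h7))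
  · rw [top_le_iff, Submodule.topologicalClosure_eq_top_iff, eq_bot_iff,
      ← ContinuousLinearMap.orthogonalComplement_iSup_eigenspaces_eq_bot hKc hKsymm]
    apply Submodule.orthogonal_le
    refine iSup_le fun ν x hx => ?_
    have hx' : K x = ν • x := Module.End.mem_eigenspace_iff.1 hx
    by_cases hx0 : x = 0
    · rw [hx0]
      exact zero_mem _
    · obtain ⟨ω, hω⟩ := hmem' ν x hx' hx0
      exact Submodule.mem_iSup_of_mem ω hω

end Operator

/-! ## The Hilbert scale `X^r = D((A*A)^{r/2})`, `r` real -/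

section Scale

variable {X : Type*} [NormedAddCommGroup X] [InnerProductSpace ℝ X] [CompleteSpace X]

/-- The weight `⟨ω⟩^r = (1 + ω²)^{r/2}`. -/
noncomputable def freqWeight (r : ℝ) (ω : ℝ≥0) : ℝ := (1 + (ω : ℝ) ^ 2) ^ (r / 2)

theorem freqWeight_pos (r : ℝ) (ω : ℝ≥0) : 0 < freqWeight r ω :=
  Real.rpow_pos_of_pos (by positivity) _

theorem freqWeight_mono {r r' : ℝ} (h : r' ≤ r) (ω : ℝ≥0) : freqWeight r' ω ≤ freqWeight r ω :=
  Real.rpow_le_rpow_of_exponent_le (by nlinarith [sq_nonneg (ω : ℝ)]) (by linarith)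

/-- The families `u = (u_ω)` of components in the eigenspaces of `(A*A)^{1/2}` with
`∑ ⟨ω⟩^{2r} ‖u_ω‖² < ∞`. -/
noncomputable def scaleSubmodule (A : X →ₗ.[ℝ] X) (r : ℝ) :
    Submodule ℝ (∀ ω : ℝ≥0, modulusEigenspace A ω) where
  carrier := {u | Memℓp (fun ω => freqWeight r ω • u ω) 2}
  add_mem' := by
    intro u v hu hv
    have h := Memℓp.add hu hv
    have e : (fun ω => freqWeight r ω • (u + v) ω)
        = (fun ω => freqWeight r ω • u ω) + fun ω => freqWeight r ω • v ω := by
      funext ω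
      simp [smul_add]
    change Memℓp (fun ω => freqWeight r ω • (u + v) ω) 2
    rw [e]
    exact h
  zero_mem' := by
    have e : (fun ω => freqWeight r ω • (0 : ∀ ω : ℝ≥0, modulusEigenspace A ω) ω) = 0 := by
      funext ω
      simp
    change Memℓp (fun ω => freqWeight r ω • (0 : ∀ ω : ℝ≥0, modulusEigenspace A ω) ω) 2
    rw [e]
    exact zero_memℓp
  smul_mem' := by
    intro c u hu
    have h := Memℓp.const_smul hu c
    have e : (fun ω => freqWeight r ω • (c • u) ω) = c • fun ω => freqWeight r ω • u ω := by
      funext ω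
      simp [smul_comm c]
    change Memℓp (fun ω => freqWeight r ω • (c • u) ω) 2
    rw [e]
    exact h

/-- The Hilbert space `X^r = D((A*A)^{r/2})`, for any real `r`. An element is given by its family
of components in the eigenspaces of `(A*A)^{1/2}`, and
`‖u‖_{X^r}² = ∑ (1 + ω²)^r ‖u_ω‖²`. For `r = 0` this is `X` (see `IsSkewAdjoint.isHilbertSum`). -/
def Scale (A : X →ₗ.[ℝ] X) (r : ℝ) : Type _ := ↥(scaleSubmodule A r)

noncomputable instance (A : X →ₗ.[ℝ] X) (r : ℝ) : AddCommGroup (Scale A r) :=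
  inferInstanceAs (AddCommGroup ↥(scaleSubmodule A r))

noncomputable instance (A : X →ₗ.[ℝ] X) (r : ℝ) : Module ℝ (Scale A r) :=
  inferInstanceAs (Module ℝ ↥(scaleSubmodule A r))

/-- The components of an element of `X^r`. -/
noncomputable def Scale.coeff (A : X →ₗ.[ℝ] X) (r : ℝ) :
    Scale A r →ₗ[ℝ] ∀ ω : ℝ≥0, modulusEigenspace A ω :=
  (scaleSubmodule A r).subtype

/-- The map `u ↦ (⟨ω⟩^r u_ω)` from `X^r` to the Hilbert sum of the eigenspaces. -/
noncomputable def Scale.toSum (A : X →ₗ.[ℝ] X) (r : ℝ) :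
    Scale A r →ₗ[ℝ] lp (fun ω : ℝ≥0 => modulusEigenspace A ω) 2 where
  toFun u := ⟨fun ω => freqWeight r ω • Scale.coeff A r u ω, u.2⟩
  map_add' u v := by
    apply Subtype.ext
    funext ω
    change freqWeight r ω • Scale.coeff A r (u + v) ω
      = freqWeight r ω • Scale.coeff A r u ω + freqWeight r ω • Scale.coeff A r v ω
    rw [map_add, Pi.add_apply, smul_add]
  map_smul' c u := by
    apply Subtype.ext
    funext ω
    change freqWeight r ω • Scale.coeff A r (c • u) ω = c • freqWeight r ω • Scale.coeff A r u ω
    rw [map_smul, Pi.smul_apply, smul_comm]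

theorem Scale.toSum_injective (A : X →ₗ.[ℝ] X) (r : ℝ) :
    Function.Injective (Scale.toSum A r) := by
  intro u v h
  apply Subtype.ext
  funext ω
  have h1 : freqWeight r ω • Scale.coeff A r u ω = freqWeight r ω • Scale.coeff A r v ω :=
    congrFun (congrArg Subtype.val h) ω
  exact smul_right_injective _ (freqWeight_pos r ω).ne' h1

noncomputable instance (A : X →ₗ.[ℝ] X) (r : ℝ) : NormedAddCommGroup (Scale A r) :=
  NormedAddCommGroup.induced (Scale A r) (lp (fun ω : ℝ≥0 => modulusEigenspace A ω) 2)
    (Scale.toSum A r) (Scale.toSum_injective A r)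

theorem Scale.norm_def {A : X →ₗ.[ℝ] X} {r : ℝ} (u : Scale A r) : ‖u‖ = ‖Scale.toSum A r u‖ :=
  rfl

noncomputable instance (A : X →ₗ.[ℝ] X) (r : ℝ) : InnerProductSpace ℝ (Scale A r) where
  norm_smul_le c u := by
    rw [Scale.norm_def, Scale.norm_def, map_smul]
    exact norm_smul_le _ _
  inner u v := ⟪Scale.toSum A r u, Scale.toSum A r v⟫_ℝ
  norm_sq_eq_re_inner u := norm_sq_eq_re_inner (𝕜 := ℝ) (Scale.toSum A r u)
  conj_inner_symm u v := inner_conj_symm _ _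
  add_left u v w := by
    change ⟪Scale.toSum A r (u + v), Scale.toSum A r w⟫_ℝ = _
    rw [map_add, inner_add_left]
  smul_left u v c := by
    change ⟪Scale.toSum A r (c • u), Scale.toSum A r v⟫_ℝ = _
    rw [map_smul, inner_smul_left]

/-- The bounded map `X^r → X^r'` that acts by `L ω` on the component in the `ω`-eigenspace. -/
noncomputable def Scale.diagonal {A : X →ₗ.[ℝ] X} {r r' : ℝ}
    (L : ∀ ω : ℝ≥0, modulusEigenspace A ω →ₗ[ℝ] modulusEigenspace A ω)
    (hL : ∀ ω x, freqWeight r' ω * ‖L ω x‖ ≤ freqWeight r ω * ‖x‖) :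
    Scale A r →L[ℝ] Scale A r' :=
  LinearMap.mkContinuous
    { toFun := fun u => ⟨fun ω => L ω (Scale.coeff A r u ω), by
        refine Memℓp.mono' (u.2 : Memℓp (fun ω => freqWeight r ω • Scale.coeff A r u ω) 2) ?_
        intro ω
        rw [norm_smul, norm_smul, Real.norm_of_nonneg (freqWeight_pos _ _).le,
          Real.norm_of_nonneg (freqWeight_pos _ _).le]
        exact hL ω _⟩
      map_add' := fun u v => Subtype.ext (funext fun ω => (L ω).map_add _ _)
      map_smul' := fun c u => Subtype.ext (funext fun ω => (L ω).map_smul _ _) }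
    1 (by
      intro u
      rw [one_mul, Scale.norm_def, Scale.norm_def]
      refine lp.norm_mono (by norm_num) ?_
      intro ω
      change ‖freqWeight r' ω • L ω (Scale.coeff A r u ω)‖ ≤ ‖freqWeight r ω • Scale.coeff A r u ω‖
      rw [norm_smul, norm_smul, Real.norm_of_nonneg (freqWeight_pos _ _).le,
        Real.norm_of_nonneg (freqWeight_pos _ _).le]
      exact hL ω _)

theorem Scale.coeff_diagonal {A : X →ₗ.[ℝ] X} {r r' : ℝ}
    (L : ∀ ω : ℝ≥0, modulusEigenspace A ω →ₗ[ℝ] modulusEigenspace A ω)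
    (hL : ∀ ω x, freqWeight r' ω * ‖L ω x‖ ≤ freqWeight r ω * ‖x‖) (u : Scale A r) (ω : ℝ≥0) :
    Scale.coeff A r' (Scale.diagonal L hL u) ω = L ω (Scale.coeff A r u ω) := rfl

/-- The embedding `X^r → X^r'` for `r' ≤ r`. -/
noncomputable def Scale.incl (A : X →ₗ.[ℝ] X) {r r' : ℝ} (h : r' ≤ r) :
    Scale A r →L[ℝ] Scale A r' :=
  Scale.diagonal (fun _ => LinearMap.id) fun ω x =>
    mul_le_mul_of_nonneg_right (freqWeight_mono h ω) (norm_nonneg x)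

/-- The power `(A*A)^s : X^r → X^r'`, for `s ≥ 0` and `r' ≤ r - 2s`. -/
noncomputable def Scale.power (A : X →ₗ.[ℝ] X) {r r' s : ℝ} (hs : 0 ≤ s) (h : r' + 2 * s ≤ r) :
    Scale A r →L[ℝ] Scale A r' :=
  Scale.diagonal (fun ω => (((ω : ℝ) ^ 2) ^ s) • LinearMap.id) (by
    intro ω x
    rw [LinearMap.smul_apply, LinearMap.id_apply, norm_smul,
      Real.norm_of_nonneg (by positivity), ← mul_assoc]
    refine mul_le_mul_of_nonneg_right ?_ (norm_nonneg x)
    refine le_trans ?_ (freqWeight_mono h ω)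
    rw [freqWeight, freqWeight, add_div, Real.rpow_add (by positivity), mul_div_cancel_left₀ s two_ne_zero]
    gcongr
    linarith)

/-- The unitary group `e^{tA}` on `X^r`. -/
noncomputable def Scale.expGroup {A : X →ₗ.[ℝ] X} (hA : IsSkewAdjoint A) (r t : ℝ) :
    Scale A r →L[ℝ] Scale A r :=
  Scale.diagonal (fun ω => hA.expOnEigenspace t ω) fun ω x =>
    (congrArg (freqWeight r ω * ·) (hA.norm_expOnEigenspace t ω x)).le

/-- The low frequency space `P_n X^r`, where `P_n = 1_{[0,n]}((A*A)^{1/2})`. -/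
noncomputable def Scale.low (A : X →ₗ.[ℝ] X) (r : ℝ) (n : ℕ) : Submodule ℝ (Scale A r) where
  carrier := {u | ∀ ω : ℝ≥0, (n : ℝ≥0) < ω → Scale.coeff A r u ω = 0}
  add_mem' := by
    intro u v hu hv ω hω
    rw [map_add, Pi.add_apply, hu ω hω, hv ω hω, add_zero]
  zero_mem' := by
    intro ω _
    rw [map_zero, Pi.zero_apply]
  smul_mem' := by
    intro c u hu ω hω
    rw [map_smul, Pi.smul_apply, hu ω hω, smul_zero]

/-- The high frequency space `Q_n X^r`, where `Q_n = I - P_n`. -/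
noncomputable def Scale.high (A : X →ₗ.[ℝ] X) (r : ℝ) (n : ℕ) : Submodule ℝ (Scale A r) where
  carrier := {u | ∀ ω : ℝ≥0, ω ≤ (n : ℝ≥0) → Scale.coeff A r u ω = 0}
  add_mem' := by
    intro u v hu hv ω hω
    rw [map_add, Pi.add_apply, hu ω hω, hv ω hω, add_zero]
  zero_mem' := by
    intro ω _
    rw [map_zero, Pi.zero_apply]
  smul_mem' := by
    intro c u hu ω hω
    rw [map_smul, Pi.smul_apply, hu ω hω, smul_zero]

open Classical in
/-- The low frequency projection `P_n`. -/
noncomputable def Scale.lowProj (A : X →ₗ.[ℝ] X) (r : ℝ) (n : ℕ) :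
    Scale A r →L[ℝ] Scale.low A r n :=
  (Scale.diagonal (fun ω => if ω ≤ (n : ℝ≥0) then LinearMap.id else 0) (by
    intro ω x
    refine mul_le_mul_of_nonneg_left ?_ (freqWeight_pos r ω).le
    split_ifs <;> simp)).codRestrict _ (by
    intro u ω hω
    rw [Scale.coeff_diagonal, if_neg hω.not_ge, LinearMap.zero_apply])

open Classical in
/-- The high frequency projection `Q_n`. -/
noncomputable def Scale.highProj (A : X →ₗ.[ℝ] X) (r : ℝ) (n : ℕ) :
    Scale A r →L[ℝ] Scale.high A r n :=
  (Scale.diagonal (fun ω => if ω ≤ (n : ℝ≥0) then 0 else LinearMap.id) (by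
    intro ω x
    refine mul_le_mul_of_nonneg_left ?_ (freqWeight_pos r ω).le
    split_ifs <;> simp)).codRestrict _ (by
    intro u ω hω
    rw [Scale.coeff_diagonal, if_pos hω, LinearMap.zero_apply])

end Scale

/-! ## Complexification of a real inner product space -/

section Complexification

/-- The complexification `Y_ℂ` of a real inner product space `Y`: the elements `y₁ + i y₂`,
with `‖y₁ + i y₂‖² = ‖y₁‖² + ‖y₂‖²`. -/
def Cplx (Y : Type*) : Type _ := WithLp 2 (Y × Y)

variable {Y : Type*}

/-- The element `y₁ + i y₂`. -/
def Cplx.mk (y₁ y₂ : Y) : Cplx Y := WithLp.toLp 2 (y₁, y₂)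

/-- The real part. -/
def Cplx.re (y : Cplx Y) : Y := (WithLp.ofLp y).1

/-- The imaginary part. -/
def Cplx.im (y : Cplx Y) : Y := (WithLp.ofLp y).2

@[ext] theorem Cplx.ext {y z : Cplx Y} (h₁ : y.re = z.re) (h₂ : y.im = z.im) : y = z :=
  WithLp.ofLp_injective 2 (Prod.ext h₁ h₂)

@[simp] theorem Cplx.re_mk (y₁ y₂ : Y) : (Cplx.mk y₁ y₂).re = y₁ := rfl

@[simp] theorem Cplx.im_mk (y₁ y₂ : Y) : (Cplx.mk y₁ y₂).im = y₂ := rfl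

variable [NormedAddCommGroup Y]

noncomputable instance : NormedAddCommGroup (Cplx Y) :=
  inferInstanceAs (NormedAddCommGroup (WithLp 2 (Y × Y)))

@[simp] theorem Cplx.re_add (y z : Cplx Y) : (y + z).re = y.re + z.re := rfl

@[simp] theorem Cplx.im_add (y z : Cplx Y) : (y + z).im = y.im + z.im := rfl

@[simp] theorem Cplx.re_zero : (0 : Cplx Y).re = 0 := rfl

@[simp] theorem Cplx.im_zero : (0 : Cplx Y).im = 0 := rfl

theorem Cplx.norm_sq (y : Cplx Y) : ‖y‖ ^ 2 = ‖y.re‖ ^ 2 + ‖y.im‖ ^ 2 :=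
  WithLp.prod_norm_sq_eq_of_L2 (α := Y) (β := Y) y

/-- The inclusion `Y → Y_ℂ`. -/
def Cplx.ofReal (y : Y) : Cplx Y := Cplx.mk y 0

theorem Cplx.isometry_ofReal : Isometry (Cplx.ofReal : Y → Cplx Y) := by
  refine Isometry.of_dist_eq fun x y => ?_
  rw [dist_eq_norm, dist_eq_norm]
  refine (sq_eq_sq₀ (norm_nonneg _) (norm_nonneg _)).1 ?_
  rw [Cplx.norm_sq]
  have h1 : (Cplx.ofReal x - Cplx.ofReal y).re = x - y := rfl
  have h2 : (Cplx.ofReal x - Cplx.ofReal y).im = 0 - 0 := rfl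
  rw [h1, h2]
  simp

variable [InnerProductSpace ℝ Y]

noncomputable instance : SMul ℂ (Cplx Y) :=
  ⟨fun z y => Cplx.mk (z.re • y.re - z.im • y.im) (z.re • y.im + z.im • y.re)⟩

@[simp] theorem Cplx.re_smul (z : ℂ) (y : Cplx Y) :
    (z • y).re = z.re • y.re - z.im • y.im := rfl

@[simp] theorem Cplx.im_smul (z : ℂ) (y : Cplx Y) :
    (z • y).im = z.re • y.im + z.im • y.re := rfl

noncomputable instance : Module ℂ (Cplx Y) where
  one_smul y := by ext <;> simp
  mul_smul z w y := by
    ext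
    · simp only [Cplx.re_smul, Cplx.im_smul, Complex.mul_re, Complex.mul_im]
      module
    · simp only [Cplx.re_smul, Cplx.im_smul, Complex.mul_re, Complex.mul_im]
      module
  smul_zero z := by ext <;> simp
  zero_smul y := by ext <;> simp
  smul_add z y w := by
    ext
    · simp only [Cplx.re_smul, Cplx.re_add, Cplx.im_add]
      module
    · simp only [Cplx.im_smul, Cplx.re_add, Cplx.im_add]
      module
  add_smul z w y := by
    ext
    · simp only [Cplx.re_smul, Cplx.re_add, Complex.add_re, Complex.add_im]
      module
    · simp only [Cplx.im_smul, Cplx.im_add, Complex.add_re, Complex.add_im]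
      module

noncomputable instance : NormedSpace ℂ (Cplx Y) where
  norm_smul_le z y := by
    refine le_of_eq ?_
    refine (sq_eq_sq₀ (norm_nonneg _) (by positivity)).1 ?_
    rw [mul_pow, Cplx.norm_sq, Cplx.norm_sq, Cplx.re_smul, Cplx.im_smul, norm_sub_sq_real,
      norm_add_sq_real, norm_smul, norm_smul, norm_smul, norm_smul, inner_smul_left,
      inner_smul_left, inner_smul_right, inner_smul_right, real_inner_comm y.re y.im,
      Complex.sq_norm, Complex.normSq_apply]
    simp only [mul_pow, Real.norm_eq_abs, sq_abs, conj_trivial]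
    ring

/-- The cylinder `{y ∈ Y_ℂ : ‖Re y‖ ≤ M, ‖Im y‖ ≤ δ}`. -/
def cylinder (Y : Type*) [NormedAddCommGroup Y] [InnerProductSpace ℝ Y] (M δ : ℝ) :
    Set (Cplx Y) := {y | ‖y.re‖ ≤ M ∧ ‖y.im‖ ≤ δ}

/-- The ball `{U ∈ C⁰(I, Y) : ‖U(t)‖ ≤ M for all t}`. -/
def pathBall (I : Type*) [TopologicalSpace I] (Y : Type*) [NormedAddCommGroup Y] (M : ℝ) :
    Set C(I, Y) := {U | ∀ t, ‖U t‖ ≤ M}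

/-- The cylinder `U₀ + {U ∈ C⁰(I, Y_ℂ) : ‖Re U(t)‖ ≤ M, ‖Im U(t)‖ ≤ δ for all t}`, where the
centre `U₀` belongs to `C⁰(I, Y)`. -/
def pathCylinder {I : Type*} [TopologicalSpace I] {Y : Type*} [NormedAddCommGroup Y]
    [InnerProductSpace ℝ Y] (U₀ : C(I, Y)) (M δ : ℝ) : Set C(I, Cplx Y) :=
  {U | ∀ t, ‖(U t).re - U₀ t‖ ≤ M ∧ ‖(U t).im‖ ≤ δ}

/-- A real path, seen as a path in the complexification. -/
def pathOfReal {I : Type*} [TopologicalSpace I] {Y : Type*} [NormedAddCommGroup Y]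
    [InnerProductSpace ℝ Y] (U : C(I, Y)) : C(I, Cplx Y) :=
  ⟨fun t => Cplx.ofReal (U t), Cplx.isometry_ofReal.continuous.comp U.continuous⟩

/-- `g` is holomorphic on a (closed) set `D`, in the sense that it is complex differentiable in the
interior of `D` and continuous up to the boundary. -/
def HolomorphicUpToBoundary {E G : Type*} [NormedAddCommGroup E] [NormedSpace ℂ E]
    [NormedAddCommGroup G] [NormedSpace ℂ G] (g : E → G) (D : Set E) : Prop :=
  DifferentiableOn ℂ g (interior D) ∧ ContinuousOn g D

end Complexification

/-! ## Observability, the nonlinearity, the commutator condition and the observed system -/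

section System

variable {X : Type*} [NormedAddCommGroup X] [InnerProductSpace ℝ X] [CompleteSpace X]
  {A : X →ₗ.[ℝ] X}

/-- `t ↦ e^{tA}` is observable on `[0, T]` in `X^r` through `C`. -/
def IsObservable (hA : IsSkewAdjoint A) (T r : ℝ) (C : Scale A r →L[ℝ] Scale A r) : Prop :=
  ∃ κ : ℝ, 0 < κ ∧ ∀ W₀ : Scale A r,
    ‖W₀‖ ^ 2 ≤ κ ^ 2 * ∫ t in (0 : ℝ)..T, ‖C (Scale.expGroup hA r t W₀)‖ ^ 2

/-- `C` is bounded on `X^σ` and on `X^{σ+ε}`, and observability holds at both levels. -/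
def ObservabilityAssumption (hA : IsSkewAdjoint A) (T σ : ℝ) {ε : ℝ} (hε : 0 < ε)
    (C : Scale A σ →L[ℝ] Scale A σ) : Prop :=
  IsObservable hA T σ C ∧
  ∃ C' : Scale A (σ + ε) →L[ℝ] Scale A (σ + ε),
    (∀ u, Scale.incl A (le_add_of_nonneg_right hε.le) (C' u)
      = C (Scale.incl A (le_add_of_nonneg_right hε.le) u)) ∧
    IsObservable hA T (σ + ε) C'

/-- `F` is bounded and Lipschitz from the ball of radius `4 R₀` of `X^σ` to `X^{σ+ε}`. Only the
values of `F` on this ball are used. -/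
def LipschitzAssumption (R₀ : ℝ) {σ ε : ℝ} (F : Scale A σ → Scale A (σ + ε)) : Prop :=
  ∃ c : ℝ, 0 < c ∧ ∀ u v : Scale A σ, ‖u‖ ≤ 4 * R₀ → ‖v‖ ≤ 4 * R₀ →
    ‖F u‖ ≤ c ∧ ‖F u - F v‖ ≤ c * ‖u - v‖

/-- `F` has a holomorphic extension, bounded and Lipschitz, to the cylinder
`‖Re u‖ ≤ 4 R₀`, `‖Im u‖ ≤ 2 δ` for some `δ > 0`. -/
def HolomorphicAssumption (R₀ : ℝ) {σ ε : ℝ} (F : Scale A σ → Scale A (σ + ε)) : Prop :=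
  ∃ (δ : ℝ) (Fc : Cplx (Scale A σ) → Cplx (Scale A (σ + ε))) (c : ℝ), 0 < δ ∧ 0 < c ∧
    (∀ u : Scale A σ, ‖u‖ ≤ 4 * R₀ → Fc (Cplx.ofReal u) = Cplx.ofReal (F u)) ∧
    HolomorphicUpToBoundary Fc (cylinder (Scale A σ) (4 * R₀) (2 * δ)) ∧
    ∀ u ∈ cylinder (Scale A σ) (4 * R₀) (2 * δ), ∀ v ∈ cylinder (Scale A σ) (4 * R₀) (2 * δ),
      ‖Fc u‖ ≤ c ∧ ‖Fc u - Fc v‖ ≤ c * ‖u - v‖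

/-- For some `s > 0`, the commutator `[(A*A)^s, C]`, which maps `X^{σ+2s}` to `X^{σ-2s}`, is
given by a bounded operator from `X^{σ+2s}` to `X^{σ+ε}`. -/
def CommutatorAssumption (A : X →ₗ.[ℝ] X) (σ : ℝ) {ε : ℝ} (hε : 0 < ε)
    (C : Scale A σ →L[ℝ] Scale A σ) : Prop :=
  ∃ (s : ℝ) (hs : 0 < s) (K : Scale A (σ + 2 * s) →L[ℝ] Scale A (σ + ε)),
    ∀ u : Scale A (σ + 2 * s),
      Scale.incl A (show σ - 2 * s ≤ σ + ε by linarith) (K u)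
        = Scale.power A hs.le (show σ - 2 * s + 2 * s ≤ σ by linarith)
            (C (Scale.incl A (show σ ≤ σ + 2 * s by linarith) u))
          - Scale.incl A (show σ - 2 * s ≤ σ by linarith)
            (C (Scale.power A hs.le (le_refl (σ + 2 * s)) u))

/-- `U ∈ C⁰([0,T], X^σ)` solves `∂ₜU = AU + F(U + H₁) + H₂`, `C U(t) = 0` on `[0, T]`, the
equation being understood in the sense of the Duhamel formula. -/
def IsObservedSolution (hA : IsSkewAdjoint A) {T : ℝ} (hT : 0 ≤ T) {σ ε : ℝ} (hε : 0 < ε)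
    (F : Scale A σ → Scale A (σ + ε)) (C : Scale A σ →L[ℝ] Scale A σ)
    (H₁ : C(Set.Icc 0 T, Scale A σ)) (H₂ : C(Set.Icc 0 T, Scale A (σ + ε)))
    (U : C(Set.Icc 0 T, Scale A σ)) : Prop :=
  (∀ t : Set.Icc 0 T, U t = Scale.expGroup hA σ t (U ⟨0, Set.left_mem_Icc.2 hT⟩)
    + ∫ s in (0 : ℝ)..t, Scale.expGroup hA σ (t - s)
        (Scale.incl A (le_add_of_nonneg_right hε.le)
          (F (U (Set.projIcc 0 T hT s) + H₁ (Set.projIcc 0 T hT s))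
            + H₂ (Set.projIcc 0 T hT s)))) ∧
  ∀ t, C (U t) = 0

/-- The low frequency part `P_n U` of a path `U` in `X^r`. -/
noncomputable def lowPath {I : Type*} [TopologicalSpace I] {r : ℝ} (n : ℕ) (U : C(I, Scale A r)) :
    C(I, Scale.low A r n) :=
  ⟨fun t => Scale.lowProj A r n (U t), (Scale.lowProj A r n).continuous.comp U.continuous⟩

/-- The high frequency part `Q_n U` of a path `U` in `X^r`. -/
noncomputable def highPath {I : Type*} [TopologicalSpace I] {r : ℝ} (n : ℕ) (U : C(I, Scale A r)) :
    C(I, Scale.high A r n) :=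
  ⟨fun t => Scale.highProj A r n (U t), (Scale.highProj A r n).continuous.comp U.continuous⟩

end System

/-! ### Closedness of the eigenspaces -/

section Eigenspaces

variable {X : Type*} [NormedAddCommGroup X] [InnerProductSpace ℝ X] [CompleteSpace X]
  {A : X →ₗ.[ℝ] X}

/-! Put G = F(U + H₁) + H₂, write E for the free evolution u ↦ e^{tA}u and D for the Duhamel
integral. Since Q_n commutes with the group, Q_nU = E Q_nU(0) + D Q_nG, and C U = 0 reads C E
Q_nU(0) = -C P_nU - C D Q_nG. Observability in X^σ says that C E is bounded below in L², so it has a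
bounded left inverse Z. Applying Z gives Q_nU(0), hence Q_nU = L P_nU + M G, where ‖L‖ is bounded
independently of n, and ‖M‖ tends to 0 because G lies in X^{σ+ε} and Q_n : X^{σ+ε} → X^σ is small.
This is `exists_reconstruction_operators`.

Thus W = Q_nU solves W = L V + M(F(V + W + H₁) + H₂) with V = P_nU. For large n, with F truncated to
be globally Lipschitz, this is a contraction in W; its fixed point is Lipschitz in (V, H₁, H₂) and,
retracted to the ball of radius R₀, is the reconstruction map.

The complexified equation, with the extension of F truncated to its cylinder, is again a
contraction. Its fixed point is complex differentiable wherever the truncation is inactive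
(`exists_parametric_fixedPoint`), because superposition with a Lipschitz holomorphic map is
differentiable on continuous paths (`differentiableAt_comp_of_lipschitzWith`). The truncation is
inactive if W stays well inside the ball, which requires L V to be small; as ‖L‖ need not be small,
this can only hold near special V.

For V = P_nU with U an unobserved solution it does hold, since L P_nU = Q_nU - M G and Q_nU is
uniformly small: U is bounded in X^{σ+ε} by `exists_regularity_bound`. To see this, regularize U(0)
by powers of J = (1 + h(A*A)^s)⁻¹. The commutator [C, J] = h J [(A*A)^s, C] J maps X^σ to X^{σ+ε}
uniformly in h, so observability in X^{σ+ε} bounds the regularized data uniformly, and h → 0. -/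

/-- The eigenvalue equation is equivalent to the fixed point equation K((ω² - μ)x) = x of a bounded
operator, K being the resolvent at μ. Closedness makes the spaces X^r complete. -/
theorem isClosed_modulusEigenspace (hK : HasCompactResolvent (adjointMulSelf A)) (ω : ℝ≥0) :
    IsClosed (modulusEigenspace A ω : Set X) := by
  obtain ⟨μ, K, -, hK1, hK2⟩ := hK
  have : (modulusEigenspace A ω : Set X) = {x | K ((((ω : ℝ) ^ 2) - μ) • x) = x} := by
    ext x
    constructor
    · rintro ⟨h, e⟩
      have := hK2 ⟨x, h⟩
      rw [e] at this
      rw [Set.mem_ofPred_eq, sub_smul]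
      exact this
    · intro h
      change K _ = x at h
      obtain ⟨h', e⟩ := hK1 ((((ω : ℝ) ^ 2) - μ) • x)
      have hx : x ∈ (adjointMulSelf A).domain := by
        rw [← h]
        exact h'
      have h1 : (⟨_, h'⟩ : (adjointMulSelf A).domain) = ⟨x, hx⟩ := Subtype.ext h
      rw [h1, h, sub_smul] at e
      exact ⟨hx, sub_left_injective e⟩
  rw [this]
  exact isClosed_eq (by fun_prop) continuous_id

theorem completeSpace_modulusEigenspace (hK : HasCompactResolvent (adjointMulSelf A)) (ω : ℝ≥0) :
    CompleteSpace (modulusEigenspace A ω) :=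
  (isClosed_modulusEigenspace hK ω).completeSpace_coe

end Eigenspaces

/-! ### Completeness of the scale, strong continuity of the group, Duhamel integral -/

namespace Scale

open Filter Topology MeasureTheory

variable {X : Type*} [NormedAddCommGroup X] [InnerProductSpace ℝ X] [CompleteSpace X]
  {A : X →ₗ.[ℝ] X} {r r' : ℝ}

theorem toSum_apply (u : Scale A r) (ω : ℝ≥0) :
    (toSum A r u : ∀ ω : ℝ≥0, modulusEigenspace A ω) ω = freqWeight r ω • coeff A r u ω := rfl

theorem norm_toSum_apply (u : Scale A r) (ω : ℝ≥0) :
    ‖(toSum A r u : ∀ ω : ℝ≥0, modulusEigenspace A ω) ω‖ = freqWeight r ω * ‖coeff A r u ω‖ := by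
  rw [toSum_apply, norm_smul, Real.norm_of_nonneg (freqWeight_pos _ _).le]

theorem ext_coeff {u v : Scale A r} (h : ∀ ω, coeff A r u ω = coeff A r v ω) : u = v :=
  Subtype.ext (funext h)

/-- The linear isometry `toSum`, as an equivalence onto the Hilbert sum of the eigenspaces. -/
noncomputable def sumEquiv (A : X →ₗ.[ℝ] X) (r : ℝ) :
    Scale A r ≃ₗᵢ[ℝ] lp (fun ω : ℝ≥0 => modulusEigenspace A ω) 2 :=
  LinearIsometryEquiv.ofSurjective ⟨toSum A r, fun _ => rfl⟩ (by
    intro f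
    have e : (fun ω => freqWeight r ω • (freqWeight r ω)⁻¹ • f ω) = fun ω => f ω := by
      funext ω
      rw [smul_smul, mul_inv_cancel₀ (freqWeight_pos _ _).ne', one_smul]
    refine ⟨⟨fun ω => (freqWeight r ω)⁻¹ • f ω, ?_⟩, ?_⟩
    · change Memℓp (fun ω => freqWeight r ω • (freqWeight r ω)⁻¹ • f ω) 2
      rw [e]
      exact f.2
    · exact Subtype.ext e)

theorem completeSpace (hK : HasCompactResolvent (adjointMulSelf A)) (r : ℝ) :
    CompleteSpace (Scale A r) := by
  have := completeSpace_modulusEigenspace hK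
  exact (completeSpace_congr (e := (sumEquiv A r).toEquiv)
    (sumEquiv A r).isometry.isUniformEmbedding).2 inferInstance

theorem norm_le_of_coeff {M : ℝ} (hM : 0 ≤ M) {u : Scale A r'} {v : Scale A r}
    (h : ∀ ω, freqWeight r' ω * ‖coeff A r' u ω‖ ≤ M * (freqWeight r ω * ‖coeff A r v ω‖)) :
    ‖u‖ ≤ M * ‖v‖ := by
  rw [norm_def, norm_def, ← Real.norm_of_nonneg hM, ← norm_smul]
  refine lp.norm_mono (by norm_num) fun ω => ?_
  rw [norm_toSum_apply, lp.coeFn_smul, Pi.smul_apply, norm_smul, norm_toSum_apply,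
    Real.norm_of_nonneg hM]
  exact h ω

theorem norm_diagonal_le
    (L : ∀ ω : ℝ≥0, modulusEigenspace A ω →ₗ[ℝ] modulusEigenspace A ω)
    (hL : ∀ ω x, freqWeight r' ω * ‖L ω x‖ ≤ freqWeight r ω * ‖x‖) (u : Scale A r) :
    ‖diagonal L hL u‖ ≤ ‖u‖ := by
  rw [← one_mul ‖u‖]
  refine norm_le_of_coeff zero_le_one fun ω => ?_
  rw [one_mul, coeff_diagonal]
  exact hL _ _

theorem coeff_incl (h : r' ≤ r) (u : Scale A r) (ω : ℝ≥0) :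
    coeff A r' (incl A h u) ω = coeff A r u ω := rfl

theorem coeff_expGroup (hA : IsSkewAdjoint A) (r t : ℝ) (u : Scale A r) (ω : ℝ≥0) :
    coeff A r (expGroup hA r t u) ω = hA.expOnEigenspace t ω (coeff A r u ω) := rfl

theorem norm_expGroup (hA : IsSkewAdjoint A) (r t : ℝ) (u : Scale A r) :
    ‖expGroup hA r t u‖ = ‖u‖ := by
  refine le_antisymm (norm_diagonal_le _ _ u) ?_
  rw [← one_mul ‖expGroup hA r t u‖]
  refine norm_le_of_coeff zero_le_one fun ω => ?_
  rw [one_mul, coeff_expGroup, hA.norm_expOnEigenspace]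

theorem incl_expGroup (hA : IsSkewAdjoint A) (h : r' ≤ r) (t : ℝ) (u : Scale A r) :
    incl A h (expGroup hA r t u) = expGroup hA r' t (incl A h u) := rfl

theorem continuous_coeff (ω : ℝ≥0) : Continuous fun u : Scale A r => coeff A r u ω := by
  have h : Continuous fun u : Scale A r =>
      (freqWeight r ω)⁻¹ • lp.evalCLM ℝ (fun ω : ℝ≥0 => modulusEigenspace A ω) 2 ω
        (sumEquiv A r u) := by
    fun_prop
  convert h using 2 with u
  change _ = (freqWeight r ω)⁻¹ • freqWeight r ω • coeff A r u ω
  rw [smul_smul, inv_mul_cancel₀ (freqWeight_pos _ _).ne', one_smul]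

theorem hasSum_norm_sq (u : Scale A r) :
    HasSum (fun ω => (freqWeight r ω * ‖coeff A r u ω‖) ^ 2) (‖u‖ ^ 2) := by
  have h := lp.hasSum_norm (p := 2) (by norm_num) (toSum A r u)
  simp only [norm_toSum_apply, ENNReal.toReal_ofNat, Real.rpow_ofNat] at h
  exact h

/-- Each component is continuous in t, and the isometry on the eigenspaces dominates the squared
differences by four times the summands of ‖u‖². Dominated convergence for series concludes. -/
theorem continuous_expGroup_apply (hA : IsSkewAdjoint A) (u : Scale A r) :
    Continuous fun t => expGroup hA r t u := by
  rw [continuous_iff_continuousAt]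
  intro t₀
  rw [ContinuousAt, tendsto_iff_norm_sub_tendsto_zero]
  have key : Tendsto (fun t => ‖expGroup hA r t u - expGroup hA r t₀ u‖ ^ 2) (𝓝 t₀) (𝓝 0) := by
    have e : ∀ t, ‖expGroup hA r t u - expGroup hA r t₀ u‖ ^ 2 = ∑' ω, (freqWeight r ω *
        ‖hA.expOnEigenspace t ω (coeff A r u ω) - hA.expOnEigenspace t₀ ω (coeff A r u ω)‖) ^ 2 :=
      fun t => (hasSum_norm_sq _).tsum_eq.symm
    simp only [e]
    have h0 : ∑' _ : ℝ≥0, (0 : ℝ) = 0 := tsum_zero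
    rw [← h0]
    refine tendsto_tsum_of_dominated_convergence
      (bound := fun ω => 4 * (freqWeight r ω * ‖coeff A r u ω‖) ^ 2)
      ((hasSum_norm_sq u).summable.mul_left 4) ?_ ?_
    · intro ω
      have hc : Continuous fun t => (freqWeight r ω *
          ‖hA.expOnEigenspace t ω (coeff A r u ω)
            - hA.expOnEigenspace t₀ ω (coeff A r u ω)‖) ^ 2 := by
        simp only [IsSkewAdjoint.expOnEigenspace, LinearMap.add_apply, LinearMap.smul_apply]
        have := Real.continuous_sinc
        fun_prop
      simpa using hc.tendsto t₀
    · refine Eventually.of_forall fun t ω => ?_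
      rw [Real.norm_of_nonneg (sq_nonneg _)]
      have h1 := norm_sub_le (hA.expOnEigenspace t ω (coeff A r u ω))
        (hA.expOnEigenspace t₀ ω (coeff A r u ω))
      rw [hA.norm_expOnEigenspace, hA.norm_expOnEigenspace] at h1
      calc _ ≤ (freqWeight r ω * (‖coeff A r u ω‖ + ‖coeff A r u ω‖)) ^ 2 := by
            have := (freqWeight_pos r ω).le
            gcongr
        _ = _ := by ring
  have h2 := key.sqrt
  simpa using h2

/-- Strong continuity and the isometry property together give joint continuity, which the Duhamel
integrand needs. -/
theorem continuous_expGroup (hA : IsSkewAdjoint A) :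
    Continuous fun p : ℝ × Scale A r => expGroup hA r p.1 p.2 := by
  rw [continuous_iff_continuousAt]
  rintro ⟨t₀, u₀⟩
  rw [ContinuousAt, tendsto_iff_norm_sub_tendsto_zero]
  have h1 : Tendsto (fun p : ℝ × Scale A r =>
      ‖p.2 - u₀‖ + ‖expGroup hA r p.1 u₀ - expGroup hA r t₀ u₀‖) (𝓝 (t₀, u₀)) (𝓝 0) := by
    have hc : Continuous fun p : ℝ × Scale A r =>
        ‖p.2 - u₀‖ + ‖expGroup hA r p.1 u₀ - expGroup hA r t₀ u₀‖ := by
      have := continuous_expGroup_apply hA u₀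
      fun_prop
    simpa using hc.tendsto (t₀, u₀)
  refine squeeze_zero (fun _ => norm_nonneg _) (fun p => ?_) h1
  calc ‖expGroup hA r p.1 p.2 - expGroup hA r t₀ u₀‖
      = ‖expGroup hA r p.1 (p.2 - u₀) + (expGroup hA r p.1 u₀ - expGroup hA r t₀ u₀)‖ := by
        rw [map_sub]; congr 1; abel
    _ ≤ _ := (norm_add_le _ _).trans_eq (by rw [norm_expGroup])

/-- The free evolution `u ↦ (t ↦ e^{tA} u)`, with values in the continuous paths. -/
noncomputable def freePath (hA : IsSkewAdjoint A) (r T : ℝ) :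
    Scale A r →L[ℝ] C(Set.Icc 0 T, Scale A r) :=
  LinearMap.mkContinuous
    { toFun := fun u => ⟨fun t => expGroup hA r t u,
        (continuous_expGroup_apply hA u).comp continuous_subtype_val⟩
      map_add' := fun u v => ContinuousMap.ext fun t => (expGroup hA r t).map_add u v
      map_smul' := fun c u => ContinuousMap.ext fun t => (expGroup hA r t).map_smul c u }
    1 (fun u => by
      rw [one_mul]
      exact (ContinuousMap.norm_le _ (norm_nonneg u)).2 fun t => (norm_expGroup hA r t u).le)

theorem continuous_duhamel_integrand (hA : IsSkewAdjoint A) {T : ℝ} (hT : 0 ≤ T)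
    (G : C(Set.Icc 0 T, Scale A r)) :
    Continuous fun p : ℝ × ℝ => expGroup hA r (p.1 - p.2) (G (Set.projIcc 0 T hT p.2)) := by
  have h3 : Continuous fun s : ℝ => G (Set.projIcc 0 T hT s) :=
    G.continuous.comp continuous_projIcc
  have h2 : Continuous fun p : ℝ × ℝ => p.1 - p.2 := by fun_prop
  exact Continuous.comp (g := fun p : ℝ × Scale A r => expGroup hA r p.1 p.2)
    (f := fun p : ℝ × ℝ => (p.1 - p.2, G (Set.projIcc 0 T hT p.2)))
    (continuous_expGroup hA) (h2.prodMk (h3.comp continuous_snd))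

/-- The path `t ↦ ∫₀ᵗ e^{(t-s)A} G(s) ds`. -/
noncomputable def duhamelPath (hA : IsSkewAdjoint A) {T : ℝ} (hT : 0 ≤ T)
    (G : C(Set.Icc 0 T, Scale A r)) : C(Set.Icc 0 T, Scale A r) where
  toFun t := ∫ s in (0 : ℝ)..t, expGroup hA r (t - s) (G (Set.projIcc 0 T hT s))
  continuous_toFun := (intervalIntegral.continuous_parametric_intervalIntegral_of_continuous
    (f := fun t s => expGroup hA r (t - s) (G (Set.projIcc 0 T hT s)))
    (continuous_duhamel_integrand hA hT G) continuous_id).comp continuous_subtype_val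

/-- The Duhamel integral `G ↦ (t ↦ ∫₀ᵗ e^{(t-s)A} G(s) ds)`. -/
noncomputable def duhamel (hA : IsSkewAdjoint A) (r : ℝ) {T : ℝ} (hT : 0 ≤ T) :
    C(Set.Icc 0 T, Scale A r) →L[ℝ] C(Set.Icc 0 T, Scale A r) :=
  LinearMap.mkContinuous
    { toFun := duhamelPath hA hT
      map_add' := fun G H => by
        ext1 t
        have h := fun G : C(Set.Icc 0 T, Scale A r) => ((continuous_duhamel_integrand hA hT G).comp
          (Continuous.prodMk_right (t : ℝ))).intervalIntegrable (μ := volume) 0 t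
        refine Eq.trans ?_ (intervalIntegral.integral_add (h G) (h H))
        exact intervalIntegral.integral_congr fun s _ =>
          (expGroup hA r (t - s)).map_add _ _
      map_smul' := fun c G => by
        ext1 t
        refine Eq.trans ?_ (intervalIntegral.integral_smul c _)
        exact intervalIntegral.integral_congr fun s _ =>
          (expGroup hA r (t - s)).map_smul _ _ }
    T (fun G => by
      refine (ContinuousMap.norm_le _ (by positivity)).2 fun t => ?_
      have h : ‖∫ s in (0 : ℝ)..t, expGroup hA r (t - s) (G (Set.projIcc 0 T hT s))‖
          ≤ ‖G‖ * |(t : ℝ) - 0| :=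
        intervalIntegral.norm_integral_le_of_norm_le_const fun s _ =>
          (norm_expGroup _ _ _ _).trans_le (G.norm_coe_le_norm _)
      refine h.trans ?_
      rw [sub_zero, abs_of_nonneg t.2.1, mul_comm]
      exact mul_le_mul_of_nonneg_right t.2.2 (norm_nonneg _))

theorem duhamel_apply (hA : IsSkewAdjoint A) (r : ℝ) {T : ℝ} (hT : 0 ≤ T)
    (G : C(Set.Icc 0 T, Scale A r)) (t : Set.Icc 0 T) :
    duhamel hA r hT G t
      = ∫ s in (0 : ℝ)..t, expGroup hA r (t - s) (G (Set.projIcc 0 T hT s)) := rfl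

theorem norm_duhamel_le (hA : IsSkewAdjoint A) (r : ℝ) {T : ℝ} (hT : 0 ≤ T) :
    ‖duhamel hA r hT‖ ≤ T :=
  LinearMap.mkContinuous_norm_le _ hT _

/-- A bounded operator that commutes with the group commutes with the Duhamel integral. -/
theorem map_duhamel (hA : IsSkewAdjoint A) (hK : HasCompactResolvent (adjointMulSelf A))
    {T : ℝ} (hT : 0 ≤ T) (L : Scale A r →L[ℝ] Scale A r')
    (hL : ∀ t u, L (expGroup hA r t u) = expGroup hA r' t (L u)) (G : C(Set.Icc 0 T, Scale A r)) :
    L.compLeftContinuous ℝ (Set.Icc 0 T) (duhamel hA r hT G)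
      = duhamel hA r' hT (L.compLeftContinuous ℝ (Set.Icc 0 T) G) := by
  have := completeSpace hK r
  have := completeSpace hK r'
  ext1 t
  change L (duhamel hA r hT G t) = duhamel hA r' hT _ t
  rw [duhamel_apply, duhamel_apply, ← ContinuousLinearMap.intervalIntegral_comp_comm]
  · exact intervalIntegral.integral_congr fun s _ => hL _ _
  · exact ((continuous_duhamel_integrand hA hT G).comp
      (Continuous.prodMk_right (t : ℝ))).intervalIntegrable _ _

end Scale

/-! ### Regularization by the resolvent of (A*A)^s -/

namespace Scale

open Filter Topology MeasureTheory

variable {X : Type*} [NormedAddCommGroup X] [InnerProductSpace ℝ X] [CompleteSpace X]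
  {A : X →ₗ.[ℝ] X} {r r' : ℝ}

theorem freqWeight_add (a b : ℝ) (ω : ℝ≥0) :
    freqWeight (a + b) ω = freqWeight a ω * freqWeight b ω := by
  rw [freqWeight, freqWeight, freqWeight, add_div, Real.rpow_add (by positivity)]

/-- The symbol `(1 + h ω^{2s})⁻¹` of the resolvent `(1 + h (A*A)^s)⁻¹`. -/
noncomputable def resolventSymbol (s h : ℝ) (ω : ℝ≥0) : ℝ := (1 + h * ((ω : ℝ) ^ 2) ^ s)⁻¹

theorem resolventSymbol_pos {s h : ℝ} (hh : 0 ≤ h) (ω : ℝ≥0) : 0 < resolventSymbol s h ω := by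
  unfold resolventSymbol
  positivity

theorem resolventSymbol_le_one {s h : ℝ} (hh : 0 ≤ h) (ω : ℝ≥0) : resolventSymbol s h ω ≤ 1 :=
  inv_le_one_of_one_le₀ (le_add_of_nonneg_right (by positivity))

/-- Combines (1 + ω²)^s ≤ 2^s (1 + ω^{2s}) with h(1 + ω^{2s}) ≤ 1 + hω^{2s}, where h ≤ 1 enters.
Uniformity in h is what survives the limit h → 0. -/
theorem freqWeight_mul_resolventSymbol_le {s h : ℝ} (hs : 0 ≤ s) (hh : 0 ≤ h) (hh1 : h ≤ 1)
    (ω : ℝ≥0) :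
    freqWeight (2 * s) ω * (((2 : ℝ) ^ s)⁻¹ * (h * resolventSymbol s h ω)) ≤ 1 := by
  have h1 : (1 + (ω : ℝ) ^ 2) ^ s ≤ 2 ^ s * (1 + ((ω : ℝ) ^ 2) ^ s) := by
    rcases le_total ((ω : ℝ) ^ 2) 1 with hω | hω
    · calc (1 + (ω : ℝ) ^ 2) ^ s ≤ 2 ^ s :=
            Real.rpow_le_rpow (by positivity) (by linarith) hs
        _ ≤ 2 ^ s * (1 + ((ω : ℝ) ^ 2) ^ s) :=
            le_mul_of_one_le_right (by positivity) (le_add_of_nonneg_right (by positivity))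
    · calc (1 + (ω : ℝ) ^ 2) ^ s ≤ (2 * (ω : ℝ) ^ 2) ^ s :=
            Real.rpow_le_rpow (by positivity) (by linarith) hs
        _ = 2 ^ s * ((ω : ℝ) ^ 2) ^ s := Real.mul_rpow (by norm_num) (by positivity)
        _ ≤ 2 ^ s * (1 + ((ω : ℝ) ^ 2) ^ s) := by gcongr; linarith
  have h2 : freqWeight (2 * s) ω = (1 + (ω : ℝ) ^ 2) ^ s := by
    rw [freqWeight, mul_div_cancel_left₀ s two_ne_zero]
  have h3 : (0 : ℝ) < 2 ^ s := by positivity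
  have h4 : 0 ≤ ((ω : ℝ) ^ 2) ^ s := by positivity
  rw [h2, resolventSymbol]
  calc (1 + (ω : ℝ) ^ 2) ^ s * (((2 : ℝ) ^ s)⁻¹ * (h * (1 + h * ((ω : ℝ) ^ 2) ^ s)⁻¹))
      ≤ (2 ^ s * (1 + ((ω : ℝ) ^ 2) ^ s))
          * (((2 : ℝ) ^ s)⁻¹ * (h * (1 + h * ((ω : ℝ) ^ 2) ^ s)⁻¹)) := by gcongr
    _ = (h + h * ((ω : ℝ) ^ 2) ^ s) / (1 + h * ((ω : ℝ) ^ 2) ^ s) := by field_simp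
    _ ≤ 1 := (div_le_one (by positivity)).2 (by linarith)

/-- The power `(1 + h (A*A)^s)^{-k}` of the resolvent of `(A*A)^s`. -/
noncomputable def resolventPow (A : X →ₗ.[ℝ] X) (r s : ℝ) {h : ℝ} (hh : 0 ≤ h) (k : ℕ) :
    Scale A r →L[ℝ] Scale A r :=
  diagonal (fun ω => (resolventSymbol s h ω) ^ k • LinearMap.id) (by
    intro ω x
    have h0 := (resolventSymbol_pos (s := s) hh ω).le
    refine mul_le_mul_of_nonneg_left ?_ (freqWeight_pos r ω).le
    rw [LinearMap.smul_apply, LinearMap.id_apply, norm_smul, Real.norm_of_nonneg (by positivity)]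
    exact mul_le_of_le_one_left (norm_nonneg _)
      (pow_le_one₀ h0 (resolventSymbol_le_one hh ω)))

theorem coeff_resolventPow {s h : ℝ} (hh : 0 ≤ h) (k : ℕ) (u : Scale A r) (ω : ℝ≥0) :
    coeff A r (resolventPow A r s hh k u) ω = resolventSymbol s h ω ^ k • coeff A r u ω := rfl

theorem norm_resolventPow_le {s h : ℝ} (hh : 0 ≤ h) (k : ℕ) (u : Scale A r) :
    ‖resolventPow A r s hh k u‖ ≤ ‖u‖ := norm_diagonal_le _ _ u

theorem resolventPow_succ {s h : ℝ} (hh : 0 ≤ h) (k : ℕ) (u : Scale A r) :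
    resolventPow A r s hh (k + 1) u = resolventPow A r s hh 1 (resolventPow A r s hh k u) := by
  refine ext_coeff fun ω => ?_
  rw [coeff_resolventPow, coeff_resolventPow, coeff_resolventPow, smul_smul, pow_succ', pow_one]

theorem resolventPow_zero {s h : ℝ} (hh : 0 ≤ h) (u : Scale A r) :
    resolventPow A r s hh 0 u = u := by
  refine ext_coeff fun ω => ?_
  rw [coeff_resolventPow, pow_zero, one_smul]

theorem resolventPow_expGroup (hA : IsSkewAdjoint A) {s h : ℝ} (hh : 0 ≤ h) (k : ℕ) (t : ℝ)
    (u : Scale A r) :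
    resolventPow A r s hh k (expGroup hA r t u) = expGroup hA r t (resolventPow A r s hh k u) := by
  refine ext_coeff fun ω => ?_
  rw [coeff_resolventPow, coeff_expGroup, coeff_expGroup, coeff_resolventPow, map_smul]

/-- The multiple `2^{-s} h (1 + h (A*A)^s)⁻¹` of the resolvent, which gains `2s` derivatives
with norm at most `1`, uniformly in `h ∈ [0, 1]`. -/
noncomputable def resolventGain (A : X →ₗ.[ℝ] X) (r : ℝ) {s h : ℝ} (hs : 0 ≤ s) (hh : 0 ≤ h)
    (hh1 : h ≤ 1) : Scale A r →L[ℝ] Scale A (r + 2 * s) :=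
  diagonal (fun ω => (((2 : ℝ) ^ s)⁻¹ * (h * resolventSymbol s h ω)) • LinearMap.id) (by
    intro ω x
    have h0 := (resolventSymbol_pos (s := s) hh ω).le
    rw [LinearMap.smul_apply, LinearMap.id_apply, norm_smul, Real.norm_of_nonneg (by positivity),
      freqWeight_add, mul_assoc, ← mul_assoc _ _ ‖x‖]
    refine mul_le_mul_of_nonneg_left ?_ (freqWeight_pos r ω).le
    exact mul_le_of_le_one_left (norm_nonneg _) (freqWeight_mul_resolventSymbol_le hs hh hh1 ω))

theorem coeff_resolventGain {s h : ℝ} (hs : 0 ≤ s) (hh : 0 ≤ h) (hh1 : h ≤ 1) (u : Scale A r)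
    (ω : ℝ≥0) : coeff A (r + 2 * s) (resolventGain A r hs hh hh1 u) ω
      = (((2 : ℝ) ^ s)⁻¹ * (h * resolventSymbol s h ω)) • coeff A r u ω := rfl

theorem coeff_power {s : ℝ} (hs : 0 ≤ s) (h : r' + 2 * s ≤ r) (u : Scale A r) (ω : ℝ≥0) :
    coeff A r' (power A hs h u) ω = (((ω : ℝ) ^ 2) ^ s) • coeff A r u ω := rfl

/-- Powers of the resolvent of `(A*A)^s` gain any number of derivatives. -/
theorem exists_lift_resolventPow {s h ε : ℝ} (hs : 0 ≤ s) (hh : 0 < h) (hh1 : h ≤ 1) {k : ℕ}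
    (hk : ε ≤ 2 * s * k) (hε : 0 ≤ ε) (u : Scale A r) :
    ∃ w : Scale A (r + ε), incl A (le_add_of_nonneg_right hε) w = resolventPow A r s hh.le k u := by
  have key : ∀ (ω : ℝ≥0) (x : modulusEigenspace A ω), freqWeight (r + ε) ω *
      ‖((((2 : ℝ) ^ s)⁻¹ * (h * resolventSymbol s h ω)) ^ k
        • (LinearMap.id : modulusEigenspace A ω →ₗ[ℝ] modulusEigenspace A ω)) x‖
      ≤ freqWeight r ω * ‖x‖ := by
    intro ω x
    have h0 := (resolventSymbol_pos (s := s) hh.le ω).le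
    have h1 := freqWeight_mul_resolventSymbol_le hs hh.le hh1 ω
    have h2 : freqWeight (2 * s * k) ω = freqWeight (2 * s) ω ^ k := by
      rw [freqWeight, freqWeight, ← Real.rpow_mul_natCast (by positivity)]
      congr 1
      ring
    have h3 := (freqWeight_pos (2 * s) ω).le
    rw [LinearMap.smul_apply, LinearMap.id_apply, norm_smul, Real.norm_of_nonneg (by positivity),
      freqWeight_add, mul_assoc, ← mul_assoc _ _ ‖x‖]
    refine mul_le_mul_of_nonneg_left ?_ (freqWeight_pos r ω).le
    refine mul_le_of_le_one_left (norm_nonneg _) ?_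
    refine (mul_le_mul_of_nonneg_right (freqWeight_mono hk ω) (by positivity)).trans ?_
    rw [h2, ← mul_pow]
    exact pow_le_one₀ (by positivity) h1
  -- The prefactor undoes the normalization of the symbol. The resulting bound blows up as h → 0,
  -- which is harmless: only membership in the smoother space is wanted here.
  refine ⟨((((2 : ℝ) ^ s)⁻¹ * h) ^ k)⁻¹ • diagonal _ key u, ext_coeff fun ω => ?_⟩
  rw [coeff_incl, map_smul, Pi.smul_apply, coeff_diagonal, coeff_resolventPow,
    LinearMap.smul_apply, LinearMap.id_apply, smul_smul, ← mul_assoc (((2 : ℝ) ^ s)⁻¹),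
    mul_pow _ (resolventSymbol s h ω), ← mul_assoc, inv_mul_cancel₀ (by positivity), one_mul]

/-- If the resolvent regularizations of `u` are bounded in `X^r'`, then `u` belongs to `X^r'`. -/
theorem exists_lift_of_bounded {s B : ℝ} (hrr : r ≤ r') (u : Scale A r) {k : ℕ}
    (H : ∀ (h : ℝ) (hh : 0 < h), h ≤ 1 →
      ∃ w : Scale A r', ‖w‖ ≤ B ∧ incl A hrr w = resolventPow A r s hh.le k u) :
    ∃ w : Scale A r', ‖w‖ ≤ B ∧ incl A hrr w = u := by
  have hpos : ∀ m : ℕ, (0 : ℝ) < 1 / ((m : ℝ) + 1) := fun m => Nat.one_div_pos_of_nat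
  have hle : ∀ m : ℕ, 1 / ((m : ℝ) + 1) ≤ 1 := fun m =>
    (div_le_one (by positivity)).2 (by linarith [(Nat.cast_nonneg m : (0 : ℝ) ≤ m)])
  choose w hwB hw using fun m : ℕ => H _ (hpos m) (hle m)
  have hlim : Tendsto (fun m ω => freqWeight r' ω • coeff A r' (w m) ω) atTop
      (𝓝 fun ω => freqWeight r' ω • coeff A r u ω) := by
    rw [tendsto_pi_nhds]
    intro ω
    have e : ∀ m, coeff A r' (w m) ω
        = resolventSymbol s (1 / ((m : ℝ) + 1)) ω ^ k • coeff A r u ω := fun m => by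
      rw [← coeff_incl hrr, hw, coeff_resolventPow]
    simp only [e]
    have h1 : Tendsto (fun m : ℕ => resolventSymbol s (1 / ((m : ℝ) + 1)) ω) atTop (𝓝 1) := by
      have h2 := (tendsto_one_div_add_atTop_nhds_zero_nat (𝕜 := ℝ)).mul_const (((ω : ℝ) ^ 2) ^ s)
      have h3 := (h2.const_add 1).inv₀ (by simp)
      simpa [resolventSymbol] using h3
    have h4 := ((h1.pow k).smul_const (coeff A r u ω)).const_smul (freqWeight r' ω)
    simpa using h4
  have hmem : Memℓp (fun ω => freqWeight r' ω • coeff A r u ω) 2 := by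
    -- Fatou's lemma: componentwise limits of a bounded family stay in ℓ².
    refine lp.memℓp_of_tendsto (F := fun m => toSum A r' (w m)) ?_ hlim
    refine isBounded_iff_forall_norm_le.2 ⟨B, ?_⟩
    rintro _ ⟨m, rfl⟩
    exact hwB m
  refine ⟨⟨fun ω => coeff A r u ω, hmem⟩, ?_, ext_coeff fun ω => rfl⟩
  exact lp.norm_le_of_tendsto (F := fun m => toSum A r' (w m))
    (Eventually.of_forall hwB) hlim

end Scale

/-! ### Regularity of unobserved data through the commutator -/

section Regularity

open Scale

variable {X : Type*} [NormedAddCommGroup X] [InnerProductSpace ℝ X] [CompleteSpace X]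
  {A : X →ₗ.[ℝ] X} {σ ε s h : ℝ}

/-- With P = (A*A)^s and J = (1 + hP)⁻¹, this is C J = J C + h J [P, C] J. The factor hJ next to v
gains 2s derivatives uniformly in h; the factor `2 ^ s` compensates the normalization of
`resolventGain`. -/
theorem map_resolventPow_one (hε : 0 < ε) (hs : 0 < s) (hh : 0 < h) (hh1 : h ≤ 1)
    (C : Scale A σ →L[ℝ] Scale A σ) (K : Scale A (σ + 2 * s) →L[ℝ] Scale A (σ + ε))
    (hcomm : ∀ u : Scale A (σ + 2 * s),
      Scale.incl A (show σ - 2 * s ≤ σ + ε by linarith) (K u)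
        = Scale.power A hs.le (show σ - 2 * s + 2 * s ≤ σ by linarith)
            (C (Scale.incl A (show σ ≤ σ + 2 * s by linarith) u))
          - Scale.incl A (show σ - 2 * s ≤ σ by linarith)
            (C (Scale.power A hs.le (le_refl (σ + 2 * s)) u))) (v : Scale A σ) :
    C (resolventPow A σ s hh.le 1 v) = resolventPow A σ s hh.le 1 (C v)
      + incl A (le_add_of_nonneg_right hε.le)
        ((2 : ℝ) ^ s • resolventPow A (σ + ε) s hh.le 1 (K (resolventGain A σ hs.le hh.le hh1 v))) := by
  set u := resolventGain A σ hs.le hh.le hh1 v with hu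
  set w := resolventPow A σ s hh.le 1 v with hw
  have h2s : (2 : ℝ) ^ s ≠ 0 := by positivity
  have e1 : incl A (show σ ≤ σ + 2 * s by linarith) u = (((2 : ℝ) ^ s)⁻¹ * h) • w := by
    refine ext_coeff fun ω => ?_
    rw [coeff_incl, hu, coeff_resolventGain, map_smul, Pi.smul_apply, hw, coeff_resolventPow,
      smul_smul, pow_one, mul_assoc]
  -- This is v = (1 + hP)Jv, with hJv written as 2^s u.
  have e2 : v = w + (2 : ℝ) ^ s • power A hs.le (le_refl (σ + 2 * s)) u := by
    refine ext_coeff fun ω => ?_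
    have h3 : (1 + h * ((ω : ℝ) ^ 2) ^ s) ≠ 0 := by positivity
    rw [map_add, map_smul, Pi.add_apply, Pi.smul_apply, coeff_power, hu, coeff_resolventGain,
      hw, coeff_resolventPow, smul_smul, smul_smul, ← add_smul]
    conv_lhs => rw [← one_smul ℝ (coeff A σ v ω)]
    congr 1
    rw [resolventSymbol]
    field_simp
  have e3 : C v = C w + (2 : ℝ) ^ s • C (power A hs.le (le_refl (σ + 2 * s)) u) := by
    conv_lhs => rw [e2, map_add, map_smul]
  refine ext_coeff fun ω => ?_
  have h3 : (1 + h * ((ω : ℝ) ^ 2) ^ s) ≠ 0 := by positivity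
  -- The terms of the commutator identity live in different spaces of the scale. Comparing
  -- components in one eigenspace lets them be combined freely.
  have e4 := congrArg (fun z => coeff A (σ - 2 * s) z ω) (hcomm u)
  simp only [map_sub, Pi.sub_apply, coeff_incl, coeff_power] at e4
  rw [e1, map_smul, map_smul, Pi.smul_apply] at e4
  rw [map_add, Pi.add_apply, coeff_incl, map_smul, Pi.smul_apply, coeff_resolventPow,
    coeff_resolventPow, e3, e4, map_add, Pi.add_apply, map_smul, Pi.smul_apply, resolventSymbol]
  match_scalars
  · field_simp
  · field_simp
    ring

/-- Each further factor J contributes one commutator of size 2^s‖K‖ and acts as a contraction on the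
earlier errors, so the errors add up. A power is needed because a single J gains only 2s
derivatives, possibly fewer than ε. -/
theorem exists_commutator_resolventPow (hε : 0 < ε) (hs : 0 < s) (hh : 0 < h) (hh1 : h ≤ 1)
    (C : Scale A σ →L[ℝ] Scale A σ) (K : Scale A (σ + 2 * s) →L[ℝ] Scale A (σ + ε))
    (hcomm : ∀ u : Scale A (σ + 2 * s),
      Scale.incl A (show σ - 2 * s ≤ σ + ε by linarith) (K u)
        = Scale.power A hs.le (show σ - 2 * s + 2 * s ≤ σ by linarith)
            (C (Scale.incl A (show σ ≤ σ + 2 * s by linarith) u))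
          - Scale.incl A (show σ - 2 * s ≤ σ by linarith)
            (C (Scale.power A hs.le (le_refl (σ + 2 * s)) u))) (k : ℕ) (v : Scale A σ) :
    ∃ b : Scale A (σ + ε), ‖b‖ ≤ k * (2 ^ s * ‖K‖) * ‖v‖ ∧
      C (resolventPow A σ s hh.le k v) = resolventPow A σ s hh.le k (C v)
        + incl A (le_add_of_nonneg_right hε.le) b := by
  induction k with
  | zero => exact ⟨0, by simp, by rw [resolventPow_zero, resolventPow_zero, map_zero, add_zero]⟩
  | succ k ih =>
    obtain ⟨b, hb, e⟩ := ih
    refine ⟨resolventPow A (σ + ε) s hh.le 1 b + (2 : ℝ) ^ s • resolventPow A (σ + ε) s hh.le 1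
      (K (resolventGain A σ hs.le hh.le hh1 (resolventPow A σ s hh.le k v))), ?_, ?_⟩
    · have h1 := norm_resolventPow_le (s := s) hh.le 1 b
      have h2 : ‖resolventPow A (σ + ε) s hh.le 1
          (K (resolventGain A σ hs.le hh.le hh1 (resolventPow A σ s hh.le k v)))‖ ≤ ‖K‖ * ‖v‖ := by
        refine (norm_resolventPow_le _ _ _).trans ((K.le_opNorm _).trans ?_)
        gcongr
        exact (norm_diagonal_le _ _ _).trans (norm_resolventPow_le _ _ _)
      refine (norm_add_le _ _).trans ?_
      rw [norm_smul, Real.norm_of_nonneg (by positivity)]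
      push_cast
      calc _ ≤ k * (2 ^ s * ‖K‖) * ‖v‖ + 2 ^ s * (‖K‖ * ‖v‖) := by
            gcongr
            exact h1.trans hb
        _ = _ := by ring
    · rw [resolventPow_succ, map_resolventPow_one hε hs hh hh1 C K hcomm, e, map_add, map_add,
        resolventPow_succ _ k (C v), add_assoc]
      rfl

/-- Regularity of the initial data of observed free evolutions: if `C e^{tA} u = -C D(t)` with
`D` bounded in `X^{σ+ε}`, then `u ∈ X^{σ+ε}`. -/
theorem exists_regularity_bound (hA : IsSkewAdjoint A) {T : ℝ} (hT : 0 < T) (hε : 0 < ε)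
    (C : Scale A σ →L[ℝ] Scale A σ) (hobs : ObservabilityAssumption hA T σ hε C)
    (hcomm : CommutatorAssumption A σ hε C) (R M : ℝ) :
    ∃ B : ℝ, ∀ (u : Scale A σ) (D : Set.Icc 0 T → Scale A (σ + ε)), ‖u‖ ≤ R → (∀ t, ‖D t‖ ≤ M) →
      (∀ t : Set.Icc 0 T, C (expGroup hA σ t u + incl A (le_add_of_nonneg_right hε.le) (D t)) = 0) →
      ∃ w : Scale A (σ + ε), ‖w‖ ≤ B ∧ incl A (le_add_of_nonneg_right hε.le) w = u := by
  obtain ⟨-, C', hC', κ, hκ, hobs'⟩ := hobs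
  obtain ⟨s, hs, K, hcomm⟩ := hcomm
  -- The k-th power of the resolvent gains 2sk ≥ ε derivatives, so it maps X^σ into X^{σ+ε}.
  obtain ⟨k, hk⟩ := exists_nat_ge (ε / (2 * s))
  rw [div_le_iff₀ (by positivity), mul_comm] at hk
  -- A bound for C e^{tA}J^k u in X^{σ+ε}: one term from the source D, one from the commutator with
  -- J^k. It is independent of h.
  set b₀ := ‖C'‖ * M + k * (2 ^ s * ‖K‖) * R
  refine ⟨Real.sqrt (κ ^ 2 * (b₀ ^ 2 * T)), fun u D hu hD hC => ?_⟩
  refine exists_lift_of_bounded (s := s) (k := k) _ u fun h hh hh1 => ?_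
  obtain ⟨w, hw⟩ := exists_lift_resolventPow hs.le hh hh1 hk hε.le u
  refine ⟨w, ?_, hw⟩
  have hbound : ∀ t ∈ Set.Icc 0 T, ‖C' (expGroup hA (σ + ε) t w)‖ ≤ b₀ := by
    intro t ht
    obtain ⟨b, hb, e⟩ :=
      exists_commutator_resolventPow hε hs hh hh1 C K hcomm k (expGroup hA σ t u)
    -- C e^{tA}J^k u = J^k C e^{tA}u + b, and the hypothesis replaces C e^{tA}u by -C D(t).
    have e1 : C' (expGroup hA (σ + ε) t w)
        = b - resolventPow A (σ + ε) s hh.le k (C' (D ⟨t, ht⟩)) := by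
      refine ext_coeff fun ω => ?_
      rw [← coeff_incl (le_add_of_nonneg_right hε.le : σ ≤ σ + ε) (C' _), hC', incl_expGroup, hw,
        ← resolventPow_expGroup, e]
      have h1 := hC ⟨t, ht⟩
      rw [map_add, ← hC'] at h1
      rw [eq_neg_of_add_eq_zero_left h1, map_neg, map_add, map_sub, map_neg, Pi.add_apply,
        Pi.sub_apply, Pi.neg_apply, coeff_incl, coeff_resolventPow, coeff_resolventPow, coeff_incl]
      abel
    rw [e1]
    refine (norm_sub_le _ _).trans ?_
    rw [add_comm]
    refine add_le_add ((norm_resolventPow_le _ _ _).trans ((C'.le_opNorm _).trans ?_))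
      (hb.trans ?_)
    · gcongr
      exact hD _
    · rw [norm_expGroup]
      gcongr
  refine Real.le_sqrt_of_sq_le ((hobs' w).trans ?_)
  gcongr
  have h3 : ‖∫ t in (0 : ℝ)..T, ‖C' (expGroup hA (σ + ε) t w)‖ ^ 2‖ ≤ b₀ ^ 2 * |T - 0| := by
    refine intervalIntegral.norm_integral_le_of_norm_le_const fun t ht => ?_
    rw [Set.uIoc_of_le hT.le] at ht
    rw [Real.norm_of_nonneg (sq_nonneg _)]
    have := hbound t ⟨ht.1.le, ht.2⟩
    gcongr
  rw [sub_zero, abs_of_pos hT] at h3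
  exact (le_abs_self _).trans h3

end Regularity

/-! ### Left inverses from lower bounds -/

section LeftInverse

open MeasureTheory

/-- An operator bounded below has closed range, and in a Hilbert space one may project orthogonally
onto it before inverting. -/
theorem ContinuousLinearMap.exists_leftInverse_of_bound {E G : Type*} [NormedAddCommGroup E]
    [InnerProductSpace ℝ E] [CompleteSpace E] [NormedAddCommGroup G] [InnerProductSpace ℝ G]
    [CompleteSpace G] (f : E →L[ℝ] G) {K : ℝ≥0} (hf : ∀ x, ‖x‖ ≤ K * ‖f x‖) :
    ∃ g : G →L[ℝ] E, ∀ x, g (f x) = x := by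
  have hanti : AntilipschitzWith K f := AddMonoidHomClass.antilipschitz_of_bound f hf
  have hclo : IsClosed (Set.range f) := hanti.isClosed_range f.uniformContinuous
  have : CompleteSpace (LinearMap.range (f : E →ₗ[ℝ] G)) := hclo.completeSpace_coe
  let e := f.equivRange hanti.injective hclo
  refine ⟨(e.symm : _ →L[ℝ] E) ∘L
    (LinearMap.range (f : E →ₗ[ℝ] G)).orthogonalProjectionOnto, fun x => ?_⟩
  rw [ContinuousLinearMap.comp_apply,
    show f x = (e x : G) from rfl, Submodule.orthogonalProjectionOnto_mem_subspace_eq_self]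
  exact e.symm_apply_apply x

theorem ContinuousMap.norm_toLp_two_sq {α E : Type*} [TopologicalSpace α] [MeasurableSpace α]
    [BorelSpace α] [CompactSpace α] [NormedAddCommGroup E] [InnerProductSpace ℝ E]
    [SecondCountableTopologyEither α E] (μ : Measure α) [IsFiniteMeasure μ] (f : C(α, E)) :
    ‖ContinuousMap.toLp 2 μ ℝ f‖ ^ 2 = ∫ a, ‖f a‖ ^ 2 ∂μ := by
  rw [← real_inner_self_eq_norm_sq, L2.inner_def]
  refine integral_congr_ae ?_
  filter_upwards [f.coeFn_toLp (p := 2) (𝕜 := ℝ) μ] with a ha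
  rw [ha, real_inner_self_eq_norm_sq]

/-- A linear map into continuous paths on `[0, T]` that is bounded below in the `L²` norm has a
left inverse that is bounded for the supremum norm. -/
theorem exists_leftInverse_of_integral_bound {E G : Type*} [NormedAddCommGroup E]
    [InnerProductSpace ℝ E] [CompleteSpace E] [NormedAddCommGroup G] [InnerProductSpace ℝ G]
    [CompleteSpace G] {T : ℝ} (hT : 0 ≤ T) (f : E →L[ℝ] C(Set.Icc 0 T, G)) {κ : ℝ} (hκ : 0 < κ)
    (hf : ∀ x, ‖x‖ ^ 2 ≤ κ ^ 2 * ∫ t in (0 : ℝ)..T, ‖f x (Set.projIcc 0 T hT t)‖ ^ 2) :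
    ∃ g : C(Set.Icc 0 T, G) →L[ℝ] E, ∀ x, g (f x) = x := by
  let μ : Measure (Set.Icc 0 T) := Measure.comap Subtype.val volume
  have hμ : IsFiniteMeasure μ := by
    refine ⟨?_⟩
    rw [comap_subtype_coe_apply measurableSet_Icc, Set.image_univ, Subtype.range_coe]
    exact measure_Icc_lt_top
  have hint : ∀ x, ∫ t in (0 : ℝ)..T, ‖f x (Set.projIcc 0 T hT t)‖ ^ 2 = ∫ t, ‖f x t‖ ^ 2 ∂μ := by
    intro x
    rw [intervalIntegral.integral_of_le hT, ← integral_Icc_eq_integral_Ioc,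
      ← integral_subtype_comap measurableSet_Icc
        (fun t : ℝ => ‖f x (Set.projIcc 0 T hT t)‖ ^ 2)]
    simp [μ]
  -- Continuous paths do not form a Hilbert space, so the inversion takes place in L². The embedding
  -- of continuous paths into L² is bounded, which restores the supremum norm.
  obtain ⟨g, hg⟩ := (ContinuousMap.toLp 2 μ ℝ ∘L f).exists_leftInverse_of_bound
    (K := ⟨κ, hκ.le⟩) fun x => by
      refine (sq_le_sq₀ (norm_nonneg _) (by positivity)).1 ?_
      rw [mul_pow, ContinuousLinearMap.comp_apply, ContinuousMap.norm_toLp_two_sq, ← hint]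
      exact hf x
  exact ⟨g ∘L ContinuousMap.toLp 2 μ ℝ, hg⟩

theorem ContinuousLinearMap.norm_compLeftContinuous_le {α E G : Type*} [TopologicalSpace α]
    [CompactSpace α] [NormedAddCommGroup E] [NormedSpace ℝ E] [NormedAddCommGroup G]
    [NormedSpace ℝ G] (L : E →L[ℝ] G) {M : ℝ} (hM : 0 ≤ M) (hL : ∀ x, ‖L x‖ ≤ M * ‖x‖) :
    ‖L.compLeftContinuous ℝ α‖ ≤ M := by
  refine ContinuousLinearMap.opNorm_le_bound _ hM fun U => ?_
  refine (ContinuousMap.norm_le _ (by positivity)).2 fun t => (hL (U t)).trans ?_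
  gcongr
  exact U.norm_coe_le_norm t

end LeftInverse

/-! ### Frequency projections -/

namespace Scale

variable {X : Type*} [NormedAddCommGroup X] [InnerProductSpace ℝ X] [CompleteSpace X]
  {A : X →ₗ.[ℝ] X} {r : ℝ} {n : ℕ}

theorem coeff_highProj_of_le (u : Scale A r) {ω : ℝ≥0} (hω : ω ≤ n) :
    coeff A r (highProj A r n u : Scale A r) ω = 0 := (highProj A r n u).2 ω hω

theorem coeff_highProj_of_lt (u : Scale A r) {ω : ℝ≥0} (hω : n < ω) :
    coeff A r (highProj A r n u : Scale A r) ω = coeff A r u ω := by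
  change (if ω ≤ (n : ℝ≥0) then 0 else LinearMap.id : _ →ₗ[ℝ] modulusEigenspace A ω) _ = _
  rw [if_neg hω.not_ge, LinearMap.id_apply]

theorem coeff_lowProj_of_le (u : Scale A r) {ω : ℝ≥0} (hω : ω ≤ n) :
    coeff A r (lowProj A r n u : Scale A r) ω = coeff A r u ω := by
  change (if ω ≤ (n : ℝ≥0) then LinearMap.id else 0 : _ →ₗ[ℝ] modulusEigenspace A ω) _ = _
  rw [if_pos hω, LinearMap.id_apply]

theorem coeff_lowProj_of_lt (u : Scale A r) {ω : ℝ≥0} (hω : n < ω) :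
    coeff A r (lowProj A r n u : Scale A r) ω = 0 := (lowProj A r n u).2 ω hω

theorem lowProj_add_highProj (u : Scale A r) :
    (lowProj A r n u : Scale A r) + (highProj A r n u : Scale A r) = u := by
  refine ext_coeff fun ω => ?_
  rw [map_add, Pi.add_apply]
  rcases le_or_gt ω (n : ℝ≥0) with hω | hω
  · rw [coeff_lowProj_of_le u hω, coeff_highProj_of_le u hω, add_zero]
  · rw [coeff_lowProj_of_lt u hω, coeff_highProj_of_lt u hω, zero_add]

theorem norm_highProj_le (u : Scale A r) : ‖highProj A r n u‖ ≤ ‖u‖ := by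
  rw [← one_mul ‖u‖]
  refine norm_le_of_coeff (u := (highProj A r n u : Scale A r)) zero_le_one fun ω => ?_
  rw [one_mul]
  refine mul_le_mul_of_nonneg_left ?_ (freqWeight_pos _ _).le
  rcases le_or_gt ω (n : ℝ≥0) with hω | hω
  · rw [coeff_highProj_of_le _ hω, norm_zero]
    exact norm_nonneg _
  · rw [coeff_highProj_of_lt _ hω]

theorem norm_lowProj_le (u : Scale A r) : ‖lowProj A r n u‖ ≤ ‖u‖ := by
  rw [← one_mul ‖u‖]
  refine norm_le_of_coeff (u := (lowProj A r n u : Scale A r)) zero_le_one fun ω => ?_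
  rw [one_mul]
  refine mul_le_mul_of_nonneg_left ?_ (freqWeight_pos _ _).le
  rcases le_or_gt ω (n : ℝ≥0) with hω | hω
  · rw [coeff_lowProj_of_le _ hω]
  · rw [coeff_lowProj_of_lt _ hω, norm_zero]
    exact norm_nonneg _

theorem highProj_highProj (u : Scale A r) :
    highProj A r n (highProj A r n u : Scale A r) = highProj A r n u := by
  refine Subtype.ext (ext_coeff fun ω => ?_)
  rcases le_or_gt ω (n : ℝ≥0) with hω | hω
  · rw [coeff_highProj_of_le _ hω, coeff_highProj_of_le _ hω]
  · rw [coeff_highProj_of_lt _ hω]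

theorem highProj_expGroup (hA : IsSkewAdjoint A) (t : ℝ) (u : Scale A r) :
    (highProj A r n (expGroup hA r t u) : Scale A r)
      = expGroup hA r t (highProj A r n u : Scale A r) := by
  refine ext_coeff fun ω => ?_
  rw [coeff_expGroup]
  rcases le_or_gt ω (n : ℝ≥0) with hω | hω
  · rw [coeff_highProj_of_le _ hω, coeff_highProj_of_le _ hω, map_zero]
  · rw [coeff_highProj_of_lt _ hω, coeff_highProj_of_lt _ hω, coeff_expGroup]

theorem freqWeight_neg_antitone {ε : ℝ} (hε : 0 ≤ ε) : Antitone (freqWeight (-ε)) := by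
  intro ω ω' h
  refine Real.rpow_le_rpow_of_nonpos (by positivity) ?_ (by linarith)
  gcongr

theorem tendsto_freqWeight_neg {ε : ℝ} (hε : 0 < ε) :
    Filter.Tendsto (fun n : ℕ => freqWeight (-ε) n) Filter.atTop (nhds 0) := by
  have h1 : Filter.Tendsto (fun n : ℕ => 1 + (n : ℝ) ^ 2) Filter.atTop Filter.atTop :=
    Filter.tendsto_atTop_add_const_left _ _
      ((Filter.tendsto_pow_atTop two_ne_zero).comp tendsto_natCast_atTop_atTop)
  have h2 := (tendsto_rpow_neg_atTop (half_pos hε)).comp h1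
  refine h2.congr fun n => ?_
  simp [freqWeight, neg_div]

/-- The high frequency part gains smallness from regularity. -/
theorem norm_highProj_incl_le {ε : ℝ} (hε : 0 ≤ ε) (u : Scale A (r + ε)) :
    ‖highProj A r n (incl A (le_add_of_nonneg_right hε) u)‖ ≤ freqWeight (-ε) n * ‖u‖ := by
  have h0 := (freqWeight_pos (-ε) n).le
  refine norm_le_of_coeff
    (u := (highProj A r n (incl A (le_add_of_nonneg_right hε) u) : Scale A r)) h0 fun ω => ?_
  rcases le_or_gt ω (n : ℝ≥0) with hω | hω
  · rw [coeff_highProj_of_le _ hω, norm_zero, mul_zero]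
    have := (freqWeight_pos (r + ε) ω).le
    positivity
  · rw [coeff_highProj_of_lt _ hω, coeff_incl, ← mul_assoc]
    refine mul_le_mul_of_nonneg_right ?_ (norm_nonneg _)
    have h1 : freqWeight r ω = freqWeight (-ε) ω * freqWeight (r + ε) ω := by
      rw [← freqWeight_add]
      congr 1
      ring
    rw [h1]
    exact mul_le_mul_of_nonneg_right (freqWeight_neg_antitone hε hω.le) (freqWeight_pos _ _).le

end Scale

/-! ### Linear reconstruction of the high frequencies -/

section Reconstruction

open Scale

variable {X : Type*} [NormedAddCommGroup X] [InnerProductSpace ℝ X] [CompleteSpace X]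
  {A : X →ₗ.[ℝ] X} {σ ε : ℝ}

/-- The embedding of paths in `X^{σ+ε}` into paths in `X^σ`. -/
noncomputable def inclPath (A : X →ₗ.[ℝ] X) (σ : ℝ) {ε T : ℝ} (hε : 0 < ε) :
    C(Set.Icc 0 T, Scale A (σ + ε)) →L[ℝ] C(Set.Icc 0 T, Scale A σ) :=
  (incl A (le_add_of_nonneg_right hε.le)).compLeftContinuous ℝ (Set.Icc 0 T)

/-- `U` is a mild solution of `∂ₜU = AU + G` on `[0, T]`. -/
def IsMildSolution (hA : IsSkewAdjoint A) {T : ℝ} (hT : 0 ≤ T) (hε : 0 < ε)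
    (G : C(Set.Icc 0 T, Scale A (σ + ε))) (U : C(Set.Icc 0 T, Scale A σ)) : Prop :=
  U = freePath hA σ T (U ⟨0, Set.left_mem_Icc.2 hT⟩) + duhamel hA σ hT (inclPath A σ hε G)

/-- Unobserved mild solutions with sources bounded in `X^{σ+ε}` are bounded in `X^{σ+ε}`, so that
their high frequency parts are small. -/
theorem exists_norm_highPath_le (hA : IsSkewAdjoint A)
    (hK : HasCompactResolvent (adjointMulSelf A)) {T : ℝ} (hT : 0 < T) (hε : 0 < ε)
    (C : Scale A σ →L[ℝ] Scale A σ) (hobs : ObservabilityAssumption hA T σ hε C)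
    (hcomm : CommutatorAssumption A σ hε C) (R M : ℝ) :
    ∃ B : ℝ, ∀ (U : C(Set.Icc 0 T, Scale A σ)) (G : C(Set.Icc 0 T, Scale A (σ + ε))),
      (∀ t, ‖U t‖ ≤ R) → ‖G‖ ≤ M → IsMildSolution hA hT.le hε G U → (∀ t, C (U t) = 0) →
      ∀ (n : ℕ) t, ‖highPath n U t‖ ≤ freqWeight (-ε) n * B := by
  obtain ⟨B, hB⟩ := exists_regularity_bound hA hT hε C hobs hcomm R (T * M)
  refine ⟨B + T * M, fun U G hU hG hsol hC n t => ?_⟩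
  set D := duhamel hA (σ + ε) hT.le G
  have hD : ∀ t, ‖D t‖ ≤ T * M := fun t => (D.norm_coe_le_norm t).trans
    (((duhamel hA (σ + ε) hT.le).le_opNorm G).trans
      (mul_le_mul (norm_duhamel_le hA _ hT.le) hG (norm_nonneg _) hT.le))
  have hU' : ∀ t, U t = expGroup hA σ t (U ⟨0, Set.left_mem_Icc.2 hT.le⟩)
      + incl A (le_add_of_nonneg_right hε.le) (D t) := by
    intro t
    have h1 := map_duhamel hA hK hT.le (incl A (le_add_of_nonneg_right hε.le : σ ≤ σ + ε))
      (fun t u => incl_expGroup hA _ t u) G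
    have h2 := congrArg (fun V => V t) hsol
    rw [ContinuousMap.add_apply, inclPath, ← h1] at h2
    exact h2
  obtain ⟨w, hw, e⟩ := hB (U ⟨0, Set.left_mem_Icc.2 hT.le⟩) D (hU _) hD fun t => by
    rw [← hU', hC]
  -- The regularity of the initial datum propagates, since the group and the Duhamel term both
  -- preserve X^{σ+ε}.
  have h3 : U t = incl A (le_add_of_nonneg_right hε.le) (expGroup hA (σ + ε) t w + D t) := by
    rw [hU', ← e, map_add, incl_expGroup]
  change ‖highProj A σ n (U t)‖ ≤ _
  rw [h3]
  refine (norm_highProj_incl_le hε.le _).trans ?_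
  refine mul_le_mul_of_nonneg_left ?_ (freqWeight_pos _ _).le
  refine (norm_add_le _ _).trans ?_
  rw [norm_expGroup]
  exact add_le_add hw (hD t)

/-- The high frequency part of an unobserved mild solution depends linearly on its low frequency
part and on the source, with a small operator in front of the source. -/
theorem exists_reconstruction_operators (hA : IsSkewAdjoint A)
    (hK : HasCompactResolvent (adjointMulSelf A)) {T : ℝ} (hT : 0 < T) (hε : 0 < ε)
    (C : Scale A σ →L[ℝ] Scale A σ) (hobs : IsObservable hA T σ C) :
    ∃ Λ B : ℝ, ∀ n : ℕ,
      ∃ (L : C(Set.Icc 0 T, Scale.low A σ n) →L[ℝ] C(Set.Icc 0 T, Scale.high A σ n))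
        (M : C(Set.Icc 0 T, Scale A (σ + ε)) →L[ℝ] C(Set.Icc 0 T, Scale.high A σ n)),
        ‖L‖ ≤ Λ ∧ ‖M‖ ≤ B * freqWeight (-ε) n ∧
        ∀ (U : C(Set.Icc 0 T, Scale A σ)) (G : C(Set.Icc 0 T, Scale A (σ + ε))),
          IsMildSolution hA hT.le hε G U → (∀ t, C (U t) = 0) →
          highPath n U = L (lowPath n U) + M G := by
  have := completeSpace hK σ
  obtain ⟨κ, hκ, hobs⟩ := hobs
  let CI := C.compLeftContinuous ℝ (Set.Icc 0 T)
  let E := freePath hA σ T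
  let D := duhamel hA σ hT.le
  obtain ⟨Z, hZ⟩ := exists_leftInverse_of_integral_bound hT.le (CI ∘L E) hκ fun x => by
    refine (hobs x).trans_eq ?_
    congr 1
    refine intervalIntegral.integral_congr fun t ht => ?_
    rw [Set.uIcc_of_le hT.le] at ht
    change _ = ‖C (expGroup hA σ (Set.projIcc 0 T hT.le t) x)‖ ^ 2
    rw [Set.projIcc_of_mem hT.le ht]
  have hZ' : ∀ x, Z (CI (E x)) = x := hZ
  -- S observes a path and returns the free evolution recovered from that observation. It does not
  -- involve n, which keeps both constants uniform in n.
  let S : C(Set.Icc 0 T, Scale A σ) →L[ℝ] C(Set.Icc 0 T, Scale A σ) := E ∘L Z ∘L CI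
  refine ⟨‖S‖, (1 + ‖S‖) * T, fun n => ?_⟩
  let PI := (lowProj A σ n).compLeftContinuous ℝ (Set.Icc 0 T)
  let QI := (highProj A σ n).compLeftContinuous ℝ (Set.Icc 0 T)
  let ιL := (Scale.low A σ n).subtypeL.compLeftContinuous ℝ (Set.Icc 0 T)
  let ιH := (Scale.high A σ n).subtypeL.compLeftContinuous ℝ (Set.Icc 0 T)
  let QJ := (highProj A σ n ∘L incl A (le_add_of_nonneg_right hε.le : σ ≤ σ + ε)).compLeftContinuous
    ℝ (Set.Icc 0 T)
  have hQ : ‖QI‖ ≤ 1 := ContinuousLinearMap.norm_compLeftContinuous_le _ zero_le_one fun u => by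
    rw [one_mul]; exact norm_highProj_le u
  have hιL : ‖ιL‖ ≤ 1 := ContinuousLinearMap.norm_compLeftContinuous_le _ zero_le_one fun u => by
    rw [one_mul]; exact le_rfl
  have hιH : ‖ιH‖ ≤ 1 := ContinuousLinearMap.norm_compLeftContinuous_le _ zero_le_one fun u => by
    rw [one_mul]; exact le_rfl
  have hQJ : ‖QJ‖ ≤ freqWeight (-ε) n :=
    ContinuousLinearMap.norm_compLeftContinuous_le _ (freqWeight_pos _ _).le fun u =>
      norm_highProj_incl_le hε.le u
  -- These are the coefficients obtained by substituting the value of Q_nU(0) from `h4` into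
  -- Duhamel's formula. The smallness of M comes entirely from `QJ`.
  refine ⟨-(QI ∘L S ∘L ιL), QI ∘L (D - S ∘L D) ∘L ιH ∘L QJ, ?_, ?_, ?_⟩
  · refine ContinuousLinearMap.opNorm_le_bound _ S.opNorm_nonneg fun V => ?_
    change ‖-(QI (S (ιL V)))‖ ≤ _
    rw [norm_neg]
    calc ‖QI (S (ιL V))‖ ≤ 1 * (‖S‖ * (1 * ‖V‖)) :=
          QI.le_of_opNorm_le_of_le hQ (S.le_opNorm_of_le (ιL.le_of_opNorm_le hιL V))
      _ = ‖S‖ * ‖V‖ := by ring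
  · have h0 := (freqWeight_pos (-ε) n).le
    refine ContinuousLinearMap.opNorm_le_bound _ (by positivity) fun G => ?_
    change ‖QI (D (ιH (QJ G)) - S (D (ιH (QJ G))))‖ ≤ _
    have hD : ‖D (ιH (QJ G))‖ ≤ T * (1 * (freqWeight (-ε) n * ‖G‖)) :=
      D.le_of_opNorm_le_of_le (norm_duhamel_le hA _ hT.le)
        (ιH.le_of_opNorm_le_of_le hιH (QJ.le_of_opNorm_le hQJ G))
    calc ‖QI (D (ιH (QJ G)) - S (D (ιH (QJ G))))‖
        ≤ 1 * (T * (1 * (freqWeight (-ε) n * ‖G‖))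
            + ‖S‖ * (T * (1 * (freqWeight (-ε) n * ‖G‖)))) :=
          QI.le_of_opNorm_le_of_le hQ ((norm_sub_le _ _).trans
            (add_le_add hD (S.le_opNorm_of_le hD)))
      _ = _ := by ring
  · intro U G hsol hC
    set U₀ := U ⟨0, Set.left_mem_Icc.2 hT.le⟩
    have h1 : ιH (QI U) = E (highProj A σ n U₀ : Scale A σ) + D (ιH (QJ G)) := by
      have h2 := map_duhamel hA hK hT.le ((Scale.high A σ n).subtypeL ∘L highProj A σ n)
        (fun t u => highProj_expGroup hA t u) (inclPath A σ hε G)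
      have h3 : ιH (QI (freePath hA σ T U₀)) = E (highProj A σ n U₀ : Scale A σ) :=
        ContinuousMap.ext fun t => highProj_expGroup hA t U₀
      calc ιH (QI U) = ιH (QI (freePath hA σ T U₀ + duhamel hA σ hT.le (inclPath A σ hε G))) := by
            rw [← show U = _ from hsol]
        _ = _ := by
            rw [map_add, map_add, h3]
            congr 1
    have h2 : ιL (PI U) + ιH (QI U) = U := ContinuousMap.ext fun t => lowProj_add_highProj (U t)
    have h3 : CI (ιL (PI U)) + CI (E (highProj A σ n U₀ : Scale A σ)) + CI (D (ιH (QJ G))) = 0 := by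
      rw [add_assoc, ← map_add CI, ← h1, ← map_add CI, h2]
      exact ContinuousMap.ext hC
    -- Z is applied to the condition C U = 0, split into low, free high and Duhamel high parts.
    have h4 : (highProj A σ n U₀ : Scale A σ) = -Z (CI (ιL (PI U))) - Z (CI (D (ιH (QJ G)))) := by
      have h5 := congrArg Z h3
      rw [map_add, map_add, hZ', map_zero] at h5
      rw [← sub_eq_zero, ← h5]
      abel
    have h6 : highPath n U = QI (ιH (QI U)) :=
      ContinuousMap.ext fun t => (highProj_highProj (U t)).symm
    rw [h6, h1, h4]
    change QI _ = -QI (E (Z (CI (ιL (PI U)))))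
      + QI (D (ιH (QJ G)) - E (Z (CI (D (ιH (QJ G))))))
    simp only [map_add, map_sub, map_neg]
    abel

end Reconstruction

/-! ### Contractions depending on a parameter -/

section FixedPoint

open Filter Topology Asymptotics

variable {𝕜 : Type*} [NontriviallyNormedField 𝕜] {P E W : Type*}
  [NormedAddCommGroup P] [NormedSpace 𝕜 P] [NormedAddCommGroup E] [NormedSpace 𝕜 E]
  [NormedAddCommGroup W] [NormedSpace 𝕜 W]

/-- The solution `w = Ψ p` of `w = L p + g (J p + ι w)`, where `g` is a contraction, depends on the
parameter `p` in a Lipschitz way, and differentiably where `g` is differentiable. -/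
theorem exists_parametric_fixedPoint [CompleteSpace W] (L : P →L[𝕜] W) (J : P →L[𝕜] E)
    (ι : W →L[𝕜] E) (hι : ∀ w, ‖ι w‖ ≤ 2 * ‖w‖) (g : E → W)
    (hg : ∀ x y, ‖g x - g y‖ ≤ 1 / 4 * ‖x - y‖) :
    ∃ Ψ : P → W, (∀ p, Ψ p = L p + g (J p + ι (Ψ p))) ∧
      (∀ p w, w = L p + g (J p + ι w) → w = Ψ p) ∧ (∃ K : ℝ≥0, LipschitzWith K Ψ) ∧
      ∀ p, DifferentiableAt 𝕜 g (J p + ι (Ψ p)) → DifferentiableAt 𝕜 Ψ p := by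
  have hgι : ∀ x w w', ‖g (x + ι w) - g (x + ι w')‖ ≤ 1 / 2 * ‖w - w'‖ := by
    intro x w w'
    refine (hg _ _).trans ?_
    rw [add_sub_add_left_eq_sub, ← map_sub]
    linarith [hι (w - w')]
  have hcontr : ∀ p, ContractingWith (1 / 2) fun w => L p + g (J p + ι w) := by
    refine fun p => ⟨by rw [← NNReal.coe_lt_coe]; norm_num, LipschitzWith.of_dist_le_mul fun w w' => ?_⟩
    rw [dist_eq_norm, dist_eq_norm, add_sub_add_left_eq_sub]
    simpa using hgι (J p) w w'
  set Ψ : P → W := fun p => (hcontr p).fixedPoint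
  have hΨ : ∀ p, Ψ p = L p + g (J p + ι (Ψ p)) := fun p => (hcontr p).fixedPoint_isFixedPt.symm
  have hlip : ∀ p q, ‖Ψ p - Ψ q‖ ≤ (2 * ‖L‖ + ‖J‖) * ‖p - q‖ := by
    intro p q
    have e : Ψ p - Ψ q = L (p - q) + (g (J p + ι (Ψ p)) - g (J q + ι (Ψ q))) := by
      conv_lhs => rw [hΨ p, hΨ q]
      rw [map_sub]
      abel
    have h1 := hg (J p + ι (Ψ p)) (J q + ι (Ψ q))
    have h2 : ‖J p + ι (Ψ p) - (J q + ι (Ψ q))‖ ≤ ‖J‖ * ‖p - q‖ + 2 * ‖Ψ p - Ψ q‖ := by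
      rw [add_sub_add_comm, ← map_sub, ← map_sub]
      exact (norm_add_le _ _).trans (add_le_add (J.le_opNorm _) (hι _))
    have h3 := norm_add_le (L (p - q)) (g (J p + ι (Ψ p)) - g (J q + ι (Ψ q)))
    rw [← e] at h3
    have h4 := L.le_opNorm (p - q)
    have h5 : 0 ≤ ‖J‖ * ‖p - q‖ := by positivity
    nlinarith
  have hlip' : LipschitzWith ⟨2 * ‖L‖ + ‖J‖, by positivity⟩ Ψ :=
    LipschitzWith.of_dist_le_mul fun p q => by
      rw [dist_eq_norm, dist_eq_norm]
      exact hlip p q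
  refine ⟨Ψ, hΨ, fun p w hw => (hcontr p).fixedPoint_unique hw.symm, ⟨_, hlip'⟩, ?_⟩
  intro p hp
  obtain ⟨g', hg'⟩ := hp
  -- A derivative inherits the Lipschitz constant of g, so 1 - g'ι is invertible by a Neumann
  -- series.
  have hg'norm : ‖g'‖ ≤ 1 / 4 :=
    hg'.le_of_lip' (by norm_num) (Eventually.of_forall fun x => hg _ _)
  have hιnorm : ‖ι‖ ≤ 2 := ContinuousLinearMap.opNorm_le_bound _ (by norm_num) hι
  have hS : ‖g' ∘L ι‖ < 1 := by
    refine (ContinuousLinearMap.opNorm_comp_le _ _).trans_lt ?_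
    nlinarith [norm_nonneg g', norm_nonneg ι]
  let S := Units.oneSub (g' ∘L ι) hS
  -- Implicit differentiation of the fixed point equation gives (1 - g'ι)Ψ' = L + g'J. As Ψ is
  -- already known to be Lipschitz, differentiability of g at the single point is enough; no C¹
  -- hypothesis is required.
  let D : P →L[𝕜] W := (↑S⁻¹ : W →L[𝕜] W) ∘L (L + g' ∘L J)
  have hSinv : ∀ w, (↑S⁻¹ : W →L[𝕜] W) (w - g' (ι w)) = w := by
    intro w
    have := congrArg (fun T : W →L[𝕜] W => T w) S.inv_mul
    simpa [S] using this
  refine ⟨D, ?_⟩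
  rw [hasFDerivAt_iff_isLittleO] at hg' ⊢
  have hx : Tendsto (fun q => J q + ι (Ψ q)) (𝓝 p) (𝓝 (J p + ι (Ψ p))) :=
    ((J.continuous.add (ι.continuous.comp hlip'.continuous)).tendsto p)
  have h1 := hg'.comp_tendsto hx
  have h2 : (fun q => J q + ι (Ψ q) - (J p + ι (Ψ p))) =O[𝓝 p] fun q => q - p := by
    refine IsBigO.of_bound (‖J‖ + 2 * (2 * ‖L‖ + ‖J‖)) (Eventually.of_forall fun q => ?_)
    rw [add_sub_add_comm, ← map_sub, ← map_sub, add_mul]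
    refine (norm_add_le _ _).trans (add_le_add (J.le_opNorm _) ((hι _).trans ?_))
    rw [mul_assoc]
    exact mul_le_mul_of_nonneg_left (hlip q p) (by norm_num)
  have h3 := ((↑S⁻¹ : W →L[𝕜] W).isBigO_comp _ (𝓝 p)).trans_isLittleO (h1.trans_isBigO h2)
  refine h3.congr_left fun q => ?_
  have e : g (J q + ι (Ψ q)) - g (J p + ι (Ψ p)) - g' (J q + ι (Ψ q) - (J p + ι (Ψ p)))
      = (Ψ q - Ψ p - g' (ι (Ψ q - Ψ p))) - (L + g' ∘L J) (q - p) := by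
    conv_rhs => rw [show Ψ q - Ψ p - g' (ι (Ψ q - Ψ p)) = L q + g (J q + ι (Ψ q))
      - (L p + g (J p + ι (Ψ p))) - g' (ι (Ψ q - Ψ p)) by rw [← hΨ, ← hΨ]]
    simp only [map_sub, map_add, add_apply, ContinuousLinearMap.comp_apply]
    abel
  change (↑S⁻¹ : W →L[𝕜] W) (g (J q + ι (Ψ q)) - g (J p + ι (Ψ p))
    - g' (J q + ι (Ψ q) - (J p + ι (Ψ p)))) = _
  rw [e, map_sub, hSinv]
  rfl

end FixedPoint

/-! ### Holomorphy of superposition operators -/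

section Superposition

open Filter Topology Asymptotics Metric

variable {E G : Type*} [NormedAddCommGroup E] [NormedSpace ℂ E] [NormedAddCommGroup G]
  [NormedSpace ℂ G]

/-- A Schwarz lemma: f minus its linear part varies by at most 2cρ on the ball and vanishes to
second order at the centre. The constant depends only on c and ρ, hence is uniform along a path;
pointwise derivatives thereby yield a derivative in the supremum norm. -/
theorem norm_sub_fderiv_le_of_lipschitzWith {f : E → G} {c : ℝ≥0} (hf : LipschitzWith c f) {x : E}
    {ρ : ℝ} (hd : DifferentiableOn ℂ f (ball x ρ)) {h : E} (hh : ‖h‖ < ρ) :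
    ‖f (x + h) - f x - fderiv ℂ f x h‖ ≤ 2 * c / ρ * ‖h‖ ^ 2 := by
  have hρ : 0 < ρ := (norm_nonneg h).trans_lt hh
  have hfd := (hd.differentiableAt (ball_mem_nhds x hρ)).hasFDerivAt
  have hn : ‖fderiv ℂ f x‖ ≤ c := hfd.le_of_lipschitz hf
  set k : E → G := fun y => f y - fderiv ℂ f x (y - x)
  have hk : ∀ y, k y - k x = f y - f x - fderiv ℂ f x (y - x) := fun y => by
    simp only [k, sub_self, map_zero, sub_zero]
    abel
  have hmaps : Set.MapsTo k (ball x ρ) (closedBall (k x) (2 * c * ρ)) := by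
    intro y hy
    rw [mem_ball, dist_eq_norm] at hy
    rw [mem_closedBall, dist_eq_norm, hk]
    have h1 := hf.norm_sub_le y x
    have h2 := (fderiv ℂ f x).le_of_opNorm_le hn (y - x)
    refine (norm_sub_le _ _).trans ?_
    have h3 := mul_le_mul_of_nonneg_left hy.le c.2
    change (c : ℝ) * _ ≤ (c : ℝ) * _ at h3
    linarith
  have hkd : DifferentiableOn ℂ k (ball x ρ) :=
    hd.sub ((fderiv ℂ f x).differentiable.comp (differentiable_id.sub_const x)).differentiableOn
  have hlo : (fun y => k y - k x) =o[𝓝 x] fun y => ‖y - x‖ ^ 1 := by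
    simp only [hk, pow_one]
    exact hfd.isLittleO.norm_right
  have h1 := Complex.dist_le_mul_div_pow_of_mapsTo_ball_of_isLittleO hkd hmaps hlo
    (z := x + h) (by simpa [dist_eq_norm] using hh)
  rw [dist_eq_norm, hk, add_sub_cancel_left, dist_eq_norm, add_sub_cancel_left] at h1
  refine h1.trans_eq ?_
  rw [one_add_one_eq_two, div_pow]
  field_simp

/-- The superposition operator of a Lipschitz map that is holomorphic near the values of a path is
complex differentiable at this path. -/
theorem differentiableAt_comp_of_lipschitzWith {I : Type*} [TopologicalSpace I] [CompactSpace I]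
    (f : C(E, G)) {c : ℝ≥0} (hf : LipschitzWith c f) (U : C(I, E)) {ρ : ℝ} (hρ : 0 < ρ)
    (hd : ∀ t, DifferentiableOn ℂ f (ball (U t) ρ)) :
    DifferentiableAt ℂ (fun V : C(I, E) => f.comp V) U := by
  have hrem : ∀ t (h : E), ‖h‖ < ρ →
      ‖f (U t + h) - f (U t) - fderiv ℂ f (U t) h‖ ≤ 2 * c / ρ * ‖h‖ ^ 2 :=
    fun t h hh => norm_sub_fderiv_le_of_lipschitzWith hf (hd t) hh
  have hcont : ∀ H : C(I, E), Continuous fun t => fderiv ℂ f (U t) (H t) := by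
    intro H
    -- Continuity of t ↦ f'(U(t))H(t) is read off difference quotients with step 1/(m+1): they are
    -- continuous in t and, by the quadratic remainder, converge uniformly.
    have hunif : TendstoUniformly (fun (m : ℕ) t => ((m : ℂ) + 1) •
        (f (U t + ((m : ℂ) + 1)⁻¹ • H t) - f (U t))) (fun t => fderiv ℂ f (U t) (H t)) atTop := by
      rw [Metric.tendstoUniformly_iff]
      intro e he
      have hlim1 : Tendsto (fun m : ℕ => 1 / ((m : ℝ) + 1) * ‖H‖) atTop (𝓝 0) := by
        simpa using (tendsto_one_div_add_atTop_nhds_zero_nat (𝕜 := ℝ)).mul_const ‖H‖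
      have hlim2 : Tendsto (fun m : ℕ => 1 / ((m : ℝ) + 1) * (2 * c / ρ * ‖H‖ ^ 2)) atTop
          (𝓝 0) := by
        simpa using (tendsto_one_div_add_atTop_nhds_zero_nat (𝕜 := ℝ)).mul_const
          (2 * c / ρ * ‖H‖ ^ 2)
      filter_upwards [hlim1.eventually_lt_const hρ, hlim2.eventually_lt_const he] with m h1 h2 t
      have hm : (0 : ℝ) < m + 1 := by positivity
      have hmc : (m : ℂ) + 1 ≠ 0 := by exact_mod_cast hm.ne'
      have hnorm : ‖(m : ℂ) + 1‖ = m + 1 := by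
        have : ((m : ℂ) + 1) = ((m + 1 : ℝ) : ℂ) := by push_cast; rfl
        rw [this, Complex.norm_real, Real.norm_of_nonneg hm.le]
      have hsm : ‖((m : ℂ) + 1)⁻¹ • H t‖ ≤ 1 / ((m : ℝ) + 1) * ‖H‖ := by
        rw [norm_smul, norm_inv, hnorm, one_div]
        gcongr
        exact H.norm_coe_le_norm t
      have h3 := hrem t _ (hsm.trans_lt h1)
      rw [dist_comm, dist_eq_norm]
      have e1 : ((m : ℂ) + 1) • (f (U t + ((m : ℂ) + 1)⁻¹ • H t) - f (U t))
          - fderiv ℂ f (U t) (H t) = ((m : ℂ) + 1) • (f (U t + ((m : ℂ) + 1)⁻¹ • H t) - f (U t)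
            - fderiv ℂ f (U t) (((m : ℂ) + 1)⁻¹ • H t)) := by
        rw [map_smul, smul_sub _ _ (((m : ℂ) + 1)⁻¹ • _), smul_smul, mul_inv_cancel₀ hmc, one_smul]
      rw [e1, norm_smul, hnorm]
      refine lt_of_le_of_lt ?_ h2
      calc ((m : ℝ) + 1) * _ ≤ (m + 1) * (2 * c / ρ * (1 / ((m : ℝ) + 1) * ‖H‖) ^ 2) := by
            gcongr
            exact h3.trans (by gcongr)
        _ = _ := by field_simp
    refine hunif.continuous (Eventually.of_forall fun m => ?_).frequently
    have := f.continuous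
    fun_prop
  have hn : ∀ t, ‖fderiv ℂ f (U t)‖ ≤ c := fun t => norm_fderiv_le_of_lipschitz ℂ hf
  let D : C(I, E) →L[ℂ] C(I, G) := LinearMap.mkContinuous
    { toFun := fun H => ⟨fun t => fderiv ℂ f (U t) (H t), hcont H⟩
      map_add' := fun H K => ContinuousMap.ext fun t => (fderiv ℂ f (U t)).map_add _ _
      map_smul' := fun z H => ContinuousMap.ext fun t => (fderiv ℂ f (U t)).map_smul _ _ } c
    fun H => (ContinuousMap.norm_le _ (by positivity)).2 fun t =>
      (fderiv ℂ f (U t)).le_of_opNorm_le_of_le (hn t) (H.norm_coe_le_norm t)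
  refine HasFDerivAt.differentiableAt (f' := D) ?_
  rw [hasFDerivAt_iff_isLittleO_nhds_zero]
  have hO : (fun H : C(I, E) => f.comp (U + H) - f.comp U - D H) =O[𝓝 0] fun H => ‖H‖ ^ 2 := by
    refine IsBigO.of_bound (2 * c / ρ) ?_
    filter_upwards [ball_mem_nhds (0 : C(I, E)) hρ] with H hH
    rw [mem_ball_zero_iff] at hH
    rw [norm_pow, norm_norm]
    refine (ContinuousMap.norm_le _ (by positivity)).2 fun t => ?_
    refine (hrem t (H t) ((H.norm_coe_le_norm t).trans_lt hH)).trans ?_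
    gcongr
    exact H.norm_coe_le_norm t
  exact hO.trans_isLittleO (isLittleO_norm_pow_id one_lt_two)

end Superposition

/-! ### Truncation to balls -/

section RadialRetraction

variable {E : Type*} [NormedAddCommGroup E] [NormedSpace ℝ E]

/-- The radial retraction of a normed space onto its closed ball of radius `R`. -/
noncomputable def radialRetraction (R : ℝ) (u : E) : E := (R / max R ‖u‖) • u

theorem radialRetraction_of_norm_le {R : ℝ} (hR : 0 < R) {u : E} (hu : ‖u‖ ≤ R) :
    radialRetraction R u = u := by
  rw [radialRetraction, max_eq_left hu, div_self hR.ne', one_smul]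

theorem norm_radialRetraction_le {R : ℝ} (hR : 0 < R) (u : E) : ‖radialRetraction R u‖ ≤ R := by
  have h : 0 < max R ‖u‖ := lt_max_of_lt_left hR
  rw [radialRetraction, norm_smul, Real.norm_of_nonneg (by positivity), div_mul_eq_mul_div,
    div_le_iff₀ h]
  exact mul_le_mul_of_nonneg_left (le_max_right _ _) hR.le

/-- One unit of the constant comes from u - v itself, the other from the variation of the scaling
factor. The argument works in any real normed space. -/
theorem norm_radialRetraction_sub_le {R : ℝ} (hR : 0 < R) (u v : E) :
    ‖radialRetraction R u - radialRetraction R v‖ ≤ 2 * ‖u - v‖ := by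
  set a := max R ‖u‖ with ha
  set b := max R ‖v‖ with hb
  have ha0 : 0 < a := lt_max_of_lt_left hR
  have hb0 : 0 < b := lt_max_of_lt_left hR
  have hab : |b - a| ≤ ‖u - v‖ := by
    refine (abs_max_sub_max_le_max _ _ _ _).trans ?_
    rw [sub_self, abs_zero, max_eq_right (abs_nonneg _), ← norm_sub_rev]
    exact abs_norm_sub_norm_le v u
  have e : radialRetraction R u - radialRetraction R v
      = (R / a) • (u - v) + (R / a * ((b - a) / b)) • v := by
    rw [radialRetraction, radialRetraction, ← ha, ← hb]
    match_scalars
    · ring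
    · field_simp
      ring
  rw [e]
  have h1 : R / a ≤ 1 := (div_le_one ha0).2 (le_max_left _ _)
  have h2 : ‖v‖ ≤ b := le_max_right _ _
  refine (norm_add_le _ _).trans ?_
  rw [norm_smul, norm_smul, norm_mul, Real.norm_of_nonneg (by positivity : 0 ≤ R / a), norm_div,
    Real.norm_eq_abs, Real.norm_of_nonneg hb0.le, two_mul]
  refine add_le_add (mul_le_of_le_one_left (norm_nonneg _) h1) ?_
  calc R / a * (|b - a| / b) * ‖v‖ ≤ 1 * (|b - a| / b) * b := by gcongr
    _ = |b - a| := by field_simp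
    _ ≤ _ := hab

end RadialRetraction

/-! ### Complexified paths, operators and truncations -/

section Complexification

variable {Y Z : Type*} [NormedAddCommGroup Y] [NormedAddCommGroup Z]

namespace Cplx

theorem re_sub (y z : Cplx Y) : (y - z).re = y.re - z.re := rfl

theorem im_sub (y z : Cplx Y) : (y - z).im = y.im - z.im := rfl

theorem norm_re_le (y : Cplx Y) : ‖y.re‖ ≤ ‖y‖ := by
  refine (sq_le_sq₀ (norm_nonneg _) (norm_nonneg _)).1 ?_
  rw [norm_sq]
  nlinarith [sq_nonneg ‖y.im‖]

theorem norm_im_le (y : Cplx Y) : ‖y.im‖ ≤ ‖y‖ := by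
  refine (sq_le_sq₀ (norm_nonneg _) (norm_nonneg _)).1 ?_
  rw [norm_sq]
  nlinarith [sq_nonneg ‖y.re‖]

theorem norm_le_add (y : Cplx Y) : ‖y‖ ≤ ‖y.re‖ + ‖y.im‖ := by
  refine (sq_le_sq₀ (norm_nonneg _) (by positivity)).1 ?_
  rw [norm_sq]
  nlinarith [mul_nonneg (norm_nonneg y.re) (norm_nonneg y.im)]

theorem continuous_re : Continuous (re : Cplx Y → Y) :=
  (LipschitzWith.of_dist_le_mul (K := 1) fun y z => by
    rw [dist_eq_norm, dist_eq_norm, ← re_sub, NNReal.coe_one, one_mul]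
    exact norm_re_le _).continuous

theorem continuous_im : Continuous (im : Cplx Y → Y) :=
  (LipschitzWith.of_dist_le_mul (K := 1) fun y z => by
    rw [dist_eq_norm, dist_eq_norm, ← im_sub, NNReal.coe_one, one_mul]
    exact norm_im_le _).continuous

theorem continuous_mk : Continuous fun p : Y × Y => mk p.1 p.2 :=
  WithLp.prod_continuous_toLp 2 Y Y

instance [CompleteSpace Y] : CompleteSpace (Cplx Y) :=
  inferInstanceAs (CompleteSpace (WithLp 2 (Y × Y)))

end Cplx

variable {I : Type*} [TopologicalSpace I]

/-- The real part of a path. -/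
noncomputable def rePath (U : C(I, Cplx Y)) : C(I, Y) := ⟨fun t => (U t).re, Cplx.continuous_re.comp U.continuous⟩

/-- The imaginary part of a path. -/
noncomputable def imPath (U : C(I, Cplx Y)) : C(I, Y) := ⟨fun t => (U t).im, Cplx.continuous_im.comp U.continuous⟩

/-- The path `U + i V`. -/
noncomputable def mkPath (U V : C(I, Y)) : C(I, Cplx Y) :=
  ⟨fun t => Cplx.mk (U t) (V t), Cplx.continuous_mk.comp (U.continuous.prodMk V.continuous)⟩

theorem path_ext {U V : C(I, Cplx Y)} (h₁ : rePath U = rePath V) (h₂ : imPath U = imPath V) :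
    U = V :=
  ContinuousMap.ext fun t => Cplx.ext (congrArg (fun W : C(I, Y) => W t) h₁)
    (congrArg (fun W : C(I, Y) => W t) h₂)

@[simp] theorem rePath_mkPath (U V : C(I, Y)) : rePath (mkPath U V) = U := rfl

@[simp] theorem imPath_mkPath (U V : C(I, Y)) : imPath (mkPath U V) = V := rfl

@[simp] theorem rePath_add (U V : C(I, Cplx Y)) : rePath (U + V) = rePath U + rePath V := rfl

@[simp] theorem imPath_add (U V : C(I, Cplx Y)) : imPath (U + V) = imPath U + imPath V := rfl

theorem norm_rePath_le [CompactSpace I] (U : C(I, Cplx Y)) : ‖rePath U‖ ≤ ‖U‖ :=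
  (ContinuousMap.norm_le _ (norm_nonneg _)).2 fun t =>
    (Cplx.norm_re_le _).trans (U.norm_coe_le_norm t)

theorem norm_imPath_le [CompactSpace I] (U : C(I, Cplx Y)) : ‖imPath U‖ ≤ ‖U‖ :=
  (ContinuousMap.norm_le _ (norm_nonneg _)).2 fun t =>
    (Cplx.norm_im_le _).trans (U.norm_coe_le_norm t)

theorem norm_le_rePath_add_imPath [CompactSpace I] (U : C(I, Cplx Y)) : ‖U‖ ≤ ‖rePath U‖ + ‖imPath U‖ :=
  (ContinuousMap.norm_le _ (by positivity)).2 fun t => (Cplx.norm_le_add _).trans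
    (add_le_add ((rePath U).norm_coe_le_norm t) ((imPath U).norm_coe_le_norm t))

variable [InnerProductSpace ℝ Y] [InnerProductSpace ℝ Z]

@[simp] theorem rePath_ofReal (U : C(I, Y)) : rePath (pathOfReal U) = U := rfl

@[simp] theorem imPath_ofReal (U : C(I, Y)) : imPath (pathOfReal U) = 0 := rfl

@[simp] theorem rePath_smul (z : ℂ) (U : C(I, Cplx Y)) :
    rePath (z • U) = z.re • rePath U - z.im • imPath U := rfl

@[simp] theorem imPath_smul (z : ℂ) (U : C(I, Cplx Y)) :
    imPath (z • U) = z.re • imPath U + z.im • rePath U := rfl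

variable [CompactSpace I]

/-- The complexification of a bounded operator between spaces of paths. -/
noncomputable def complexifyPath (L : C(I, Y) →L[ℝ] C(I, Z)) :
    C(I, Cplx Y) →L[ℂ] C(I, Cplx Z) :=
  LinearMap.mkContinuous
    { toFun := fun U => mkPath (L (rePath U)) (L (imPath U))
      map_add' := fun U V => by
        apply path_ext <;> simp
      map_smul' := fun z U => by
        apply path_ext <;> simp }
    (2 * ‖L‖) (fun U => by
      refine (norm_le_rePath_add_imPath _).trans ?_
      have h1 := L.le_opNorm_of_le (norm_rePath_le U)
      have h2 := L.le_opNorm_of_le (norm_imPath_le U)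
      change ‖L (rePath U)‖ + ‖L (imPath U)‖ ≤ _
      linarith)

@[simp] theorem rePath_complexifyPath (L : C(I, Y) →L[ℝ] C(I, Z)) (U : C(I, Cplx Y)) :
    rePath (complexifyPath L U) = L (rePath U) := rfl

@[simp] theorem imPath_complexifyPath (L : C(I, Y) →L[ℝ] C(I, Z)) (U : C(I, Cplx Y)) :
    imPath (complexifyPath L U) = L (imPath U) := rfl

/-- The factor 2 results from bounding real and imaginary parts separately; the contraction
constants leave room for it. -/
theorem norm_complexifyPath_le (L : C(I, Y) →L[ℝ] C(I, Z)) (U : C(I, Cplx Y)) :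
    ‖complexifyPath L U‖ ≤ 2 * ‖L‖ * ‖U‖ :=
  (complexifyPath L).le_of_opNorm_le (LinearMap.mkContinuous_norm_le _ (by positivity) _) U

theorem complexifyPath_ofReal (L : C(I, Y) →L[ℝ] C(I, Z)) (U : C(I, Y)) :
    complexifyPath L (pathOfReal U) = pathOfReal (L U) := by
  apply path_ext <;> simp

/-- The retraction of the complexification onto a cylinder. -/
noncomputable def cylinderRetraction (R δ : ℝ) (y : Cplx Y) : Cplx Y :=
  Cplx.mk (radialRetraction R y.re) (radialRetraction δ y.im)

theorem cylinderRetraction_mem {R δ : ℝ} (hR : 0 < R) (hδ : 0 < δ) (y : Cplx Y) :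
    cylinderRetraction R δ y ∈ cylinder Y R δ :=
  ⟨norm_radialRetraction_le hR _, norm_radialRetraction_le hδ _⟩

theorem cylinderRetraction_of_mem {R δ : ℝ} (hR : 0 < R) (hδ : 0 < δ) {y : Cplx Y}
    (hy : y ∈ cylinder Y R δ) : cylinderRetraction R δ y = y :=
  Cplx.ext (radialRetraction_of_norm_le hR hy.1) (radialRetraction_of_norm_le hδ hy.2)

/-- Real points stay real, so the truncated extension of F agrees with the truncated F on real
paths. -/
theorem cylinderRetraction_ofReal {R δ : ℝ} (hδ : 0 < δ) (y : Y) :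
    cylinderRetraction R δ (Cplx.ofReal y) = Cplx.ofReal (radialRetraction R y) :=
  Cplx.ext rfl (radialRetraction_of_norm_le hδ (by rw [Cplx.ofReal, Cplx.im_mk, norm_zero]; exact hδ.le))

theorem norm_cylinderRetraction_sub_le {R δ : ℝ} (hR : 0 < R) (hδ : 0 < δ) (y z : Cplx Y) :
    ‖cylinderRetraction R δ y - cylinderRetraction R δ z‖ ≤ 2 * ‖y - z‖ := by
  refine (sq_le_sq₀ (norm_nonneg _) (by positivity)).1 ?_
  rw [mul_pow, Cplx.norm_sq, Cplx.norm_sq, mul_add, ← mul_pow, ← mul_pow]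
  have h1 := norm_radialRetraction_sub_le hR y.re z.re
  have h2 := norm_radialRetraction_sub_le hδ y.im z.im
  exact add_le_add (pow_le_pow_left₀ (norm_nonneg _) h1 2) (pow_le_pow_left₀ (norm_nonneg _) h2 2)

end Complexification

/-! ### The nonlinear reconstruction map and its holomorphic extensions -/

section ReconstructionMap

theorem LipschitzWith.norm_comp_sub_comp_le {I E G : Type*} [TopologicalSpace I] [CompactSpace I]
    [NormedAddCommGroup E] [NormedAddCommGroup G] (f : C(E, G)) {c : ℝ≥0} (hf : LipschitzWith c f)
    (U V : C(I, E)) : ‖f.comp U - f.comp V‖ ≤ c * ‖U - V‖ :=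
  (ContinuousMap.norm_le _ (by positivity)).2 fun t => (hf.norm_sub_le _ _).trans
    (mul_le_mul_of_nonneg_left ((U - V).norm_coe_le_norm t) c.2)

theorem pathOfReal_add {I Y : Type*} [TopologicalSpace I] [NormedAddCommGroup Y]
    [InnerProductSpace ℝ Y] (U V : C(I, Y)) :
    pathOfReal (U + V) = pathOfReal U + pathOfReal V := by
  apply path_ext <;> simp

theorem mem_pathBall_iff {I Y : Type*} [TopologicalSpace I] [CompactSpace I]
    [NormedAddCommGroup Y] {M : ℝ} (hM : 0 ≤ M) {U : C(I, Y)} : U ∈ pathBall I Y M ↔ ‖U‖ ≤ M :=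
  (ContinuousMap.norm_le _ hM).symm

theorem mem_pathCylinder_iff {I Y : Type*} [TopologicalSpace I] [CompactSpace I]
    [NormedAddCommGroup Y] [InnerProductSpace ℝ Y] {M δ : ℝ} (hM : 0 ≤ M) (hδ : 0 ≤ δ)
    {U₀ : C(I, Y)} {U : C(I, Cplx Y)} :
    U ∈ pathCylinder U₀ M δ ↔ ‖rePath U - U₀‖ ≤ M ∧ ‖imPath U‖ ≤ δ := by
  rw [ContinuousMap.norm_le _ hM, ContinuousMap.norm_le _ hδ]
  exact forall_and

theorem ball_subset_cylinder {Y : Type*} [NormedAddCommGroup Y] [InnerProductSpace ℝ Y]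
    {a b M δ ρ : ℝ} {y : Cplx Y} (h₁ : ‖y.re‖ ≤ a) (h₂ : ‖y.im‖ ≤ b) (ha : a + ρ ≤ M)
    (hb : b + ρ ≤ δ) : Metric.ball y ρ ⊆ cylinder Y M δ := by
  intro z hz
  rw [Metric.mem_ball, dist_eq_norm] at hz
  have h3 := (Cplx.norm_re_le (z - y)).trans hz.le
  have h4 := (Cplx.norm_im_le (z - y)).trans hz.le
  rw [Cplx.re_sub] at h3
  rw [Cplx.im_sub] at h4
  constructor
  · linarith [norm_le_norm_add_norm_sub' z.re y.re]
  · linarith [norm_le_norm_add_norm_sub' z.im y.im]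

variable {I VL Y Y' VH : Type*} [TopologicalSpace I] [CompactSpace I]
  [NormedAddCommGroup VL] [InnerProductSpace ℝ VL] [NormedAddCommGroup Y] [InnerProductSpace ℝ Y]
  [NormedAddCommGroup Y'] [InnerProductSpace ℝ Y'] [NormedAddCommGroup VH]
  [InnerProductSpace ℝ VH] [CompleteSpace VH]

/-- The solution map of `W = L V + M (F(V + W + H₁) + H₂)`, truncated to a ball, with its local
holomorphic extensions. -/
theorem exists_reconstruction_map (jL : VL →L[ℝ] Y) (hjL : ∀ v, ‖jL v‖ ≤ ‖v‖) (jH : VH →L[ℝ] Y)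
    (hjH : ∀ v, ‖jH v‖ ≤ ‖v‖) (L : C(I, VL) →L[ℝ] C(I, VH)) (M : C(I, Y') →L[ℝ] C(I, VH))
    {R₀ R₁ c δ Λ m : ℝ} (hR₀ : 0 < R₀) (hR₁ : 0 < R₁) (hc : 0 < c) (hδ : 0 < δ)
    (hL : ‖L‖ ≤ Λ) (hM : ‖M‖ ≤ m) (hm : 16 * c * m ≤ 1) (hmR : m * (c + R₁) ≤ R₀ / 8)
    (hmδ : m * (c + R₁) ≤ δ / 2) (F : Y → Y')
    (hF : ∀ u v : Y, ‖u‖ ≤ 4 * R₀ → ‖v‖ ≤ 4 * R₀ → ‖F u - F v‖ ≤ c * ‖u - v‖) :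
    ∃ R : C(I, VL) × C(I, Y) × C(I, Y') → C(I, VH),
      (∀ p, R p ∈ pathBall I VH R₀) ∧ (∃ K : ℝ≥0, LipschitzWith K R) ∧
      (∀ V H₁ H₂ W G, W ∈ pathBall I VH R₀ → (∀ t, ‖jL (V t) + jH (W t) + H₁ t‖ ≤ 4 * R₀) →
        (∀ t, G t = F (jL (V t) + jH (W t) + H₁ t) + H₂ t) → W = L V + M G →
        W = R (V, H₁, H₂)) ∧
      ∀ Fc : Cplx Y → Cplx Y',
        (∀ u, ‖u‖ ≤ 4 * R₀ → Fc (Cplx.ofReal u) = Cplx.ofReal (F u)) →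
        HolomorphicUpToBoundary Fc (cylinder Y (4 * R₀) (2 * δ)) →
        (∀ u ∈ cylinder Y (4 * R₀) (2 * δ), ∀ v ∈ cylinder Y (4 * R₀) (2 * δ),
          ‖Fc u‖ ≤ c ∧ ‖Fc u - Fc v‖ ≤ c * ‖u - v‖) →
        ∃ η : ℝ, 0 < η ∧ ∀ V₀ ∈ pathBall I VL R₀, ‖L V₀‖ ≤ R₀ / 4 →
          ∃ Rc : C(I, Cplx VL) × C(I, Cplx Y) × C(I, Cplx Y') → C(I, Cplx VH),
            HolomorphicUpToBoundary Rc (pathCylinder V₀ η η ×ˢ pathCylinder (0 : C(I, Y)) R₀ η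
              ×ˢ pathCylinder (0 : C(I, Y')) R₁ R₁) ∧
            Set.MapsTo Rc (pathCylinder V₀ η η ×ˢ pathCylinder (0 : C(I, Y)) R₀ η
              ×ˢ pathCylinder (0 : C(I, Y')) R₁ R₁) (pathCylinder (0 : C(I, VH)) R₀ δ) ∧
            ∀ V, ∀ G₁ ∈ pathBall I Y R₀, ∀ G₂ ∈ pathBall I Y' R₁, (∀ t, ‖V t - V₀ t‖ ≤ η) →
              Rc (pathOfReal V, pathOfReal G₁, pathOfReal G₂) = pathOfReal (R (V, G₁, G₂)) := by
  have h4R : 0 < 4 * R₀ := by positivity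
  have h2δ : 0 < 2 * δ := by positivity
  have hm0 : 0 ≤ m := M.opNorm_nonneg.trans hM
  have hΛ0 : 0 ≤ Λ := L.opNorm_nonneg.trans hL
  let JL := jL.compLeftContinuous ℝ I
  let JH := jH.compLeftContinuous ℝ I
  have hJL : ∀ V, ‖JL V‖ ≤ ‖V‖ := fun V => (ContinuousMap.norm_le _ (norm_nonneg _)).2 fun t =>
    (hjL _).trans (V.norm_coe_le_norm t)
  have hJH : ∀ V, ‖JH V‖ ≤ ‖V‖ := fun V => (ContinuousMap.norm_le _ (norm_nonneg _)).2 fun t =>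
    (hjH _).trans (V.norm_coe_le_norm t)
  -- Truncating the argument makes F globally Lipschitz, at the price of doubling its constant; the
  -- fixed point problem is then posed on whole spaces.
  have hfLip : LipschitzWith ⟨2 * c, by positivity⟩ fun u : Y => F (radialRetraction (4 * R₀) u) :=
    LipschitzWith.of_dist_le_mul fun u v => by
      rw [dist_eq_norm, dist_eq_norm]
      refine (hF _ _ (norm_radialRetraction_le h4R _) (norm_radialRetraction_le h4R _)).trans ?_
      have := mul_le_mul_of_nonneg_left (norm_radialRetraction_sub_le h4R u v) hc.le
      change _ ≤ 2 * c * ‖u - v‖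
      linarith
  let f : C(Y, Y') := ⟨fun u => F (radialRetraction (4 * R₀) u), hfLip.continuous⟩
  have hfLip' : LipschitzWith ⟨2 * c, by positivity⟩ f := hfLip
  obtain ⟨Ψ, hΨ, hΨu, ⟨K, hΨL⟩, -⟩ := exists_parametric_fixedPoint (𝕜 := ℝ)
    (P := C(I, VL) × C(I, Y) × C(I, Y'))
    (L ∘L ContinuousLinearMap.fst ℝ _ _
      + M ∘L ContinuousLinearMap.snd ℝ _ _ ∘L ContinuousLinearMap.snd ℝ _ _)
    (JL ∘L ContinuousLinearMap.fst ℝ _ _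
      + ContinuousLinearMap.fst ℝ _ _ ∘L ContinuousLinearMap.snd ℝ _ _)
    JH (fun w => by linarith [hJH w, norm_nonneg w]) (fun x => M (f.comp x)) (fun x y => by
      rw [← map_sub]
      refine (M.le_of_opNorm_le_of_le hM (hfLip'.norm_comp_sub_comp_le f x y)).trans ?_
      change m * (2 * c * ‖x - y‖) ≤ _
      nlinarith [norm_nonneg (x - y)])
  have hρcont : Continuous (radialRetraction R₀ : VH → VH) :=
    (LipschitzWith.of_dist_le_mul (K := 2) fun u v => by
      rw [dist_eq_norm, dist_eq_norm]
      exact norm_radialRetraction_sub_le hR₀ u v).continuous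
  let ρ : C(VH, VH) := ⟨radialRetraction R₀, hρcont⟩
  have hρLip : LipschitzWith 2 ρ := LipschitzWith.of_dist_le_mul fun u v => by
    rw [dist_eq_norm, dist_eq_norm]
    exact norm_radialRetraction_sub_le hR₀ u v
  have hρid : ∀ W ∈ pathBall I VH R₀, ρ.comp W = W := fun W hW =>
    ContinuousMap.ext fun t => radialRetraction_of_norm_le hR₀ (hW t)
  -- The outer retraction forces values in the ball for every parameter, and leaves fixed points
  -- already in the ball unchanged.
  refine ⟨fun p => ρ.comp (Ψ p), fun p t => norm_radialRetraction_le hR₀ _, ⟨2 * K, ?_⟩, ?_, ?_⟩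
  · refine LipschitzWith.of_dist_le_mul fun p q => ?_
    rw [dist_eq_norm]
    refine (hρLip.norm_comp_sub_comp_le ρ _ _).trans ?_
    have := hΨL.dist_le_mul p q
    rw [dist_eq_norm] at this
    push_cast
    linarith
  · intro V H₁ H₂ W G hW hbound hG hWG
    have hGf : G = f.comp (JL V + H₁ + JH W) + H₂ := by
      refine ContinuousMap.ext fun t => ?_
      rw [hG t]
      change _ = F (radialRetraction (4 * R₀) (jL (V t) + H₁ t + jH (W t))) + H₂ t
      rw [add_right_comm (jL (V t)) (H₁ t), radialRetraction_of_norm_le h4R (hbound t)]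
    have h1 := hΨu (V, H₁, H₂) W (by
      change W = L V + M H₂ + M (f.comp (JL V + H₁ + JH W))
      conv_lhs => rw [hWG, hGf, map_add]
      abel)
    change W = ρ.comp (Ψ _)
    rw [← h1, hρid W hW]
  · intro Fc hFc hholo hFcL
    have hfcLip : LipschitzWith ⟨2 * c, by positivity⟩
        fun u : Cplx Y => Fc (cylinderRetraction (4 * R₀) (2 * δ) u) :=
      LipschitzWith.of_dist_le_mul fun u v => by
        rw [dist_eq_norm, dist_eq_norm]
        refine (hFcL _ (cylinderRetraction_mem h4R h2δ u) _
          (cylinderRetraction_mem h4R h2δ v)).2.trans ?_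
        have := mul_le_mul_of_nonneg_left (norm_cylinderRetraction_sub_le h4R h2δ u v) hc.le
        change _ ≤ 2 * c * ‖u - v‖
        linarith
    let fc : C(Cplx Y, Cplx Y') :=
      ⟨fun u => Fc (cylinderRetraction (4 * R₀) (2 * δ) u), hfcLip.continuous⟩
    have hfcLip' : LipschitzWith ⟨2 * c, by positivity⟩ fc := hfcLip
    -- The truncated extension is bounded on the whole space, so the fixed point can be estimated
    -- without knowing beforehand that the truncation is inactive.
    have hfcb : ∀ x : C(I, Cplx Y), ‖fc.comp x‖ ≤ c := fun x =>
      (ContinuousMap.norm_le _ hc.le).2 fun t =>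
        (hFcL _ (cylinderRetraction_mem h4R h2δ _) _ (cylinderRetraction_mem h4R h2δ (x t))).1
    have hfcreal : ∀ x : C(I, Y), fc.comp (pathOfReal x) = pathOfReal (f.comp x) := fun x =>
      ContinuousMap.ext fun t => by
        change Fc (cylinderRetraction (4 * R₀) (2 * δ) (Cplx.ofReal (x t)))
          = Cplx.ofReal (F (radialRetraction (4 * R₀) (x t)))
        rw [cylinderRetraction_ofReal h2δ, hFc _ (norm_radialRetraction_le h4R _)]
    obtain ⟨Φ, hΦ, hΦu, ⟨K', hΦL⟩, hΦd⟩ := exists_parametric_fixedPoint (𝕜 := ℂ)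
      (P := C(I, Cplx VL) × C(I, Cplx Y) × C(I, Cplx Y'))
      (complexifyPath L ∘L ContinuousLinearMap.fst ℂ _ _
        + complexifyPath M ∘L ContinuousLinearMap.snd ℂ _ _ ∘L ContinuousLinearMap.snd ℂ _ _)
      (complexifyPath JL ∘L ContinuousLinearMap.fst ℂ _ _
        + ContinuousLinearMap.fst ℂ _ _ ∘L ContinuousLinearMap.snd ℂ _ _)
      (complexifyPath JH) (fun w => by
        have h1 := norm_le_rePath_add_imPath (complexifyPath JH w)
        rw [rePath_complexifyPath, imPath_complexifyPath] at h1
        linarith [(hJH (rePath w)).trans (norm_rePath_le w),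
          (hJH (imPath w)).trans (norm_imPath_le w)])
      (fun x => complexifyPath M (fc.comp x)) (fun x y => by
        rw [← map_sub]
        refine (norm_complexifyPath_le _ _).trans ?_
        have h1 : ‖fc.comp x - fc.comp y‖ ≤ 2 * c * ‖x - y‖ := hfcLip'.norm_comp_sub_comp_le fc x y
        -- Complexification doubles ‖M‖ and truncation doubles c: the Lipschitz constant 4cm is at
        -- most 1/4 because 16cm ≤ 1.
        have h2 : 2 * ‖M‖ * ‖fc.comp x - fc.comp y‖ ≤ 2 * m * (2 * c * ‖x - y‖) := by gcongr
        nlinarith [norm_nonneg (x - y)])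
    have hΦ' : ∀ V H₁ H₂, Φ (V, H₁, H₂) = complexifyPath L V
        + complexifyPath M (fc.comp (complexifyPath JL V + H₁ + complexifyPath JH (Φ (V, H₁, H₂)))
          + H₂) := by
      intro V H₁ H₂
      have h1 : Φ (V, H₁, H₂) = complexifyPath L V + complexifyPath M H₂
        + complexifyPath M (fc.comp (complexifyPath JL V + H₁
          + complexifyPath JH (Φ (V, H₁, H₂)))) := hΦ (V, H₁, H₂)
      rw [map_add, add_comm (complexifyPath M _), ← add_assoc]
      exact h1
    -- By uniqueness of the complex fixed point, real parameters give the real fixed point.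
    have hΦreal : ∀ V H₁ H₂, Φ (pathOfReal V, pathOfReal H₁, pathOfReal H₂)
        = pathOfReal (Ψ (V, H₁, H₂)) := by
      intro V H₁ H₂
      refine (hΦu _ _ ?_).symm
      have h1 : Ψ (V, H₁, H₂) = L V + M H₂ + M (f.comp (JL V + H₁ + JH (Ψ (V, H₁, H₂)))) :=
        hΨ (V, H₁, H₂)
      change _ = complexifyPath L (pathOfReal V) + complexifyPath M (pathOfReal H₂)
        + complexifyPath M (fc.comp (complexifyPath JL (pathOfReal V) + pathOfReal H₁
          + complexifyPath JH (pathOfReal (Ψ (V, H₁, H₂)))))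
      simp only [complexifyPath_ofReal, ← pathOfReal_add, hfcreal]
      exact congrArg _ h1
    -- With (Λ + 1)η = a, both η and Λη are at most a: moving V within the cylinder costs at most
    -- R₀/8 in the real part and δ/4 in the imaginary part.
    set a := min (R₀ / 8) (δ / 4) with ha
    have ha0 : 0 < a := lt_min (by positivity) (by positivity)
    set η := a / (Λ + 1) with hη
    have hη0 : 0 < η := by positivity
    have hηa : (Λ + 1) * η = a := by rw [hη]; field_simp
    have haR : a ≤ R₀ / 8 := min_le_left _ _
    have haδ : a ≤ δ / 4 := min_le_right _ _
    have hΛη0 : 0 ≤ Λ * η := by positivity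
    refine ⟨η, hη0, fun V₀ hV₀ hLV₀ => ⟨Φ, ?_⟩⟩
    rw [mem_pathBall_iff hR₀.le] at hV₀
    set D := pathCylinder V₀ η η ×ˢ pathCylinder (0 : C(I, Y)) R₀ η
              ×ˢ pathCylinder (0 : C(I, Y')) R₁ R₁
    -- Real part: R₀/4 from L V₀, R₀/8 from the displacement of V and R₀/8 from M. Imaginary part:
    -- δ/4 and δ/2 from the last two. L and M act on the two parts separately, so no factor 2
    -- appears.
    have hbound : ∀ p ∈ D, ‖rePath (Φ p)‖ ≤ R₀ / 2 ∧ ‖imPath (Φ p)‖ ≤ δ := by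
      rintro ⟨V, H₁, H₂⟩ ⟨hV, hH₁, hH₂⟩
      rw [mem_pathCylinder_iff hη0.le hη0.le] at hV
      rw [mem_pathCylinder_iff hR₁.le hR₁.le, sub_zero] at hH₂
      set x := complexifyPath JL V + H₁ + complexifyPath JH (Φ (V, H₁, H₂))
      rw [hΦ' V H₁ H₂]
      simp only [rePath_add, imPath_add, rePath_complexifyPath, imPath_complexifyPath]
      have h1 : ‖M (rePath (fc.comp x) + rePath H₂)‖ ≤ m * (c + R₁) :=
        M.le_of_opNorm_le_of_le hM ((norm_add_le _ _).trans
          (add_le_add ((norm_rePath_le _).trans (hfcb x)) hH₂.1))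
      have h2 : ‖M (imPath (fc.comp x) + imPath H₂)‖ ≤ m * (c + R₁) :=
        M.le_of_opNorm_le_of_le hM ((norm_add_le _ _).trans
          (add_le_add ((norm_imPath_le _).trans (hfcb x)) hH₂.2))
      have h3 : ‖L (imPath V)‖ ≤ Λ * η := L.le_of_opNorm_le_of_le hL hV.2
      have h4 : ‖L (rePath V)‖ ≤ R₀ / 4 + Λ * η := by
        have e : L (rePath V) = L V₀ + L (rePath V - V₀) := by rw [map_sub]; abel
        rw [e]
        exact (norm_add_le _ _).trans (add_le_add hLV₀ (L.le_of_opNorm_le_of_le hL hV.1))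
      constructor
      · refine (norm_add_le _ _).trans ?_
        linarith
      · refine (norm_add_le _ _).trans ?_
        linarith
    refine ⟨⟨?_, hΦL.continuous.continuousOn⟩, ?_, ?_⟩
    · refine DifferentiableOn.mono (t := D) (fun p hp => ?_) interior_subset
      refine (hΦd p ?_).differentiableWithinAt
      have hp' := hbound p hp
      obtain ⟨V, H₁, H₂⟩ := p
      obtain ⟨hV, hH₁, hH₂⟩ := hp
      rw [mem_pathCylinder_iff hη0.le hη0.le] at hV
      rw [mem_pathCylinder_iff hR₀.le hη0.le, sub_zero] at hH₁
      change DifferentiableAt ℂ (fun x => complexifyPath M (fc.comp x))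
        (complexifyPath JL V + H₁ + complexifyPath JH (Φ (V, H₁, H₂)))
      set x := complexifyPath JL V + H₁ + complexifyPath JH (Φ (V, H₁, H₂)) with hx
      have hxre : ‖rePath x‖ ≤ 3 * R₀ := by
        have h1 := norm_le_norm_add_norm_sub' (rePath V) V₀
        have h2 : ‖rePath x‖ ≤ ‖rePath V‖ + ‖rePath H₁‖ + ‖rePath (Φ (V, H₁, H₂))‖ := by
          rw [hx]
          simp only [rePath_add, rePath_complexifyPath]
          exact norm_add₃_le.trans (by gcongr <;> [exact hJL _; exact hJH _])
        linarith [hV.1, hH₁.1, hp'.1]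
      have hxim : ‖imPath x‖ ≤ 3 / 2 * δ := by
        have h2 : ‖imPath x‖ ≤ ‖imPath V‖ + ‖imPath H₁‖ + ‖imPath (Φ (V, H₁, H₂))‖ := by
          rw [hx]
          simp only [imPath_add, imPath_complexifyPath]
          exact norm_add₃_le.trans (by gcongr <;> [exact hJL _; exact hJH _])
        linarith [hV.2, hH₁.2, hp'.2]
      -- The argument of the nonlinearity stays in the cylinder of radii 3R₀ and 3δ/2. The gap to
      -- 4R₀ and 2δ provides a radius independent of t on which the truncation is the identity.
      have hsub : ∀ t, Metric.ball (x t) (min R₀ (δ / 2)) ⊆ cylinder Y (4 * R₀) (2 * δ) := fun t =>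
        ball_subset_cylinder (((rePath x).norm_coe_le_norm t).trans hxre)
          (((imPath x).norm_coe_le_norm t).trans hxim)
          (by linarith [min_le_left R₀ (δ / 2)]) (by linarith [min_le_right R₀ (δ / 2)])
      have h1 : DifferentiableAt ℂ (fun x => fc.comp x) x := by
        refine differentiableAt_comp_of_lipschitzWith fc hfcLip' x
          (lt_min hR₀ (half_pos hδ)) fun t => ?_
        refine (hholo.1.mono (interior_maximal (hsub t) Metric.isOpen_ball)).congr fun y hy => ?_
        change Fc (cylinderRetraction (4 * R₀) (2 * δ) y) = Fc y
        rw [cylinderRetraction_of_mem h4R h2δ (hsub t hy)]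
      exact (complexifyPath M).differentiableAt.comp x h1
    · intro p hp
      rw [mem_pathCylinder_iff hR₀.le hδ.le, sub_zero]
      exact ⟨(hbound p hp).1.trans (by linarith), (hbound p hp).2⟩
    · intro V G₁ hG₁ G₂ hG₂ hV
      rw [hΦreal]
      have hmem : (pathOfReal V, pathOfReal G₁, pathOfReal G₂) ∈ D := by
        refine ⟨fun t => ⟨hV t, ?_⟩, fun t => ⟨?_, ?_⟩, fun t => ⟨?_, ?_⟩⟩
        · change ‖(0 : VL)‖ ≤ η
          rw [norm_zero]
          exact hη0.le
        · change ‖G₁ t - 0‖ ≤ R₀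
          rw [sub_zero]
          exact hG₁ t
        · change ‖(0 : Y)‖ ≤ η
          rw [norm_zero]
          exact hη0.le
        · change ‖G₂ t - 0‖ ≤ R₁
          rw [sub_zero]
          exact hG₂ t
        · change ‖(0 : Y')‖ ≤ R₁
          rw [norm_zero]
          exact hR₁.le
      have h1 := (hbound _ hmem).1
      -- The real fixed point has norm at most R₀/2 here, so the outer retraction in the real map
      -- does nothing.
      rw [hΦreal, rePath_ofReal] at h1
      change _ = pathOfReal (ρ.comp (Ψ _))
      rw [hρid _ ((mem_pathBall_iff hR₀.le).2 (h1.trans (by linarith)))]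

end ReconstructionMap

/-! ### Choice of the cutoff and conclusion -/

section MainTheorem

variable {X : Type*} [NormedAddCommGroup X] [InnerProductSpace ℝ X] [CompleteSpace X]
  {A : X →ₗ.[ℝ] X} {σ ε : ℝ}

/-- Closedness makes Q_nX^σ complete, as the fixed point argument demands. -/
theorem isClosed_high (r : ℝ) (n : ℕ) : IsClosed (Scale.high A r n : Set (Scale A r)) := by
  have e : (Scale.high A r n : Set (Scale A r))
      = ⋂ (ω : ℝ≥0) (_ : ω ≤ (n : ℝ≥0)), {u | Scale.coeff A r u ω = 0} := by
    ext u
    simp only [Set.mem_iInter]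
    rfl
  rw [e]
  exact isClosed_iInter fun ω => isClosed_iInter fun _ =>
    isClosed_eq (Scale.continuous_coeff ω) continuous_const

/-- Observed solutions are mild solutions whose source is a path in `X^{σ+ε}`. -/
theorem IsObservedSolution.exists_source (hA : IsSkewAdjoint A) {T : ℝ} (hT : 0 ≤ T)
    (hε : 0 < ε) {F : Scale A σ → Scale A (σ + ε)} {C : Scale A σ →L[ℝ] Scale A σ} {R₀ R₁ c : ℝ}
    (hR₀ : 0 ≤ R₀) (hR₁ : 0 ≤ R₁) (hc : 0 ≤ c)
    (hF : ∀ u v : Scale A σ, ‖u‖ ≤ 4 * R₀ → ‖v‖ ≤ 4 * R₀ →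
      ‖F u‖ ≤ c ∧ ‖F u - F v‖ ≤ c * ‖u - v‖)
    {U H₁ : C(Set.Icc 0 T, Scale A σ)} {H₂ : C(Set.Icc 0 T, Scale A (σ + ε))}
    (hU : U ∈ pathBall (Set.Icc 0 T) (Scale A σ) R₀)
    (hH₁ : H₁ ∈ pathBall (Set.Icc 0 T) (Scale A σ) R₀)
    (hH₂ : H₂ ∈ pathBall (Set.Icc 0 T) (Scale A (σ + ε)) R₁)
    (hsol : IsObservedSolution hA hT hε F C H₁ H₂ U) :
    ∃ G : C(Set.Icc 0 T, Scale A (σ + ε)), (∀ t, G t = F (U t + H₁ t) + H₂ t) ∧ ‖G‖ ≤ c + R₁ ∧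
      IsMildSolution hA hT hε G U := by
  have hb : ∀ t, ‖U t + H₁ t‖ ≤ 4 * R₀ := fun t =>
    (norm_add_le _ _).trans (by linarith [hU t, hH₁ t])
  have hFc : ContinuousOn F {u | ‖u‖ ≤ 4 * R₀} :=
    (LipschitzOnWith.of_dist_le_mul (K := ⟨c, hc⟩) fun u hu v hv => by
      rw [dist_eq_norm, dist_eq_norm]
      exact (hF u v hu hv).2).continuousOn
  let G : C(Set.Icc 0 T, Scale A (σ + ε)) := ⟨fun t => F (U t + H₁ t) + H₂ t,
    (hFc.comp_continuous (U + H₁).continuous hb).add H₂.continuous⟩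
  refine ⟨G, fun t => rfl, ?_, ?_⟩
  · exact (ContinuousMap.norm_le _ (by positivity)).2 fun t => (norm_add_le _ _).trans
      (add_le_add (hF _ _ (hb t) (hb t)).1 (hH₂ t))
  · exact ContinuousMap.ext fun t => hsol.1 t

end MainTheorem

theorem mainTheorem8 {X : Type*} [NormedAddCommGroup X] [InnerProductSpace ℝ X] [CompleteSpace X]
    [TopologicalSpace.SeparableSpace X]
    (A : X →ₗ.[ℝ] X) (hA : IsSkewAdjoint A) (hK : HasCompactResolvent (adjointMulSelf A))
    (T : ℝ) (hT : 0 < T) (σ : ℝ) (hσ : σ ∈ Set.Icc (0 : ℝ) 1) (ε : ℝ) (hε : 0 < ε)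
    (R₀ R₁ : ℝ) (hR₀ : 0 < R₀) (hR₁ : 0 < R₁)
    (C : Scale A σ →L[ℝ] Scale A σ) (hobs : ObservabilityAssumption hA T σ hε C)
    (hcomm : CommutatorAssumption A σ hε C)
    (F : Scale A σ → Scale A (σ + ε)) (hF : LipschitzAssumption R₀ F) :
    ∃ (n : ℕ) (R : C(Set.Icc 0 T, Scale.low A σ n) × C(Set.Icc 0 T, Scale A σ)
        × C(Set.Icc 0 T, Scale A (σ + ε)) → C(Set.Icc 0 T, Scale.high A σ n)),
      Set.MapsTo R
        (pathBall (Set.Icc 0 T) (Scale.low A σ n) R₀ ×ˢ pathBall (Set.Icc 0 T) (Scale A σ) R₀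
          ×ˢ pathBall (Set.Icc 0 T) (Scale A (σ + ε)) R₁)
        (pathBall (Set.Icc 0 T) (Scale.high A σ n) R₀) ∧
      (∃ L : ℝ≥0, LipschitzOnWith L R
        (pathBall (Set.Icc 0 T) (Scale.low A σ n) R₀ ×ˢ pathBall (Set.Icc 0 T) (Scale A σ) R₀
          ×ˢ pathBall (Set.Icc 0 T) (Scale A (σ + ε)) R₁)) ∧
      (∀ U ∈ pathBall (Set.Icc 0 T) (Scale A σ) R₀, ∀ H₁ ∈ pathBall (Set.Icc 0 T) (Scale A σ) R₀,
        ∀ H₂ ∈ pathBall (Set.Icc 0 T) (Scale A (σ + ε)) R₁,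
        IsObservedSolution hA hT.le hε F C H₁ H₂ U →
          highPath n U = R (lowPath n U, H₁, H₂)) ∧
      (HolomorphicAssumption R₀ F →
        ∃ η η₁ : ℝ, 0 < η ∧ 0 < η₁ ∧
          ∀ U ∈ pathBall (Set.Icc 0 T) (Scale A σ) R₀,
          ∀ H₁ ∈ pathBall (Set.Icc 0 T) (Scale A σ) R₀,
          ∀ H₂ ∈ pathBall (Set.Icc 0 T) (Scale A (σ + ε)) R₁,
          IsObservedSolution hA hT.le hε F C H₁ H₂ U →
            ∃ Rc : C(Set.Icc 0 T, Cplx (Scale.low A σ n)) × C(Set.Icc 0 T, Cplx (Scale A σ))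
                × C(Set.Icc 0 T, Cplx (Scale A (σ + ε))) →
                C(Set.Icc 0 T, Cplx (Scale.high A σ n)),
              HolomorphicUpToBoundary Rc
                (pathCylinder (lowPath n U) η η
                  ×ˢ pathCylinder (0 : C(Set.Icc 0 T, Scale A σ)) R₀ η
                  ×ˢ pathCylinder (0 : C(Set.Icc 0 T, Scale A (σ + ε))) R₁ R₁) ∧
              Set.MapsTo Rc
                (pathCylinder (lowPath n U) η η
                  ×ˢ pathCylinder (0 : C(Set.Icc 0 T, Scale A σ)) R₀ η
                  ×ˢ pathCylinder (0 : C(Set.Icc 0 T, Scale A (σ + ε))) R₁ R₁)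
                (pathCylinder (0 : C(Set.Icc 0 T, Scale.high A σ n)) R₀ η₁) ∧
              ∀ V ∈ pathBall (Set.Icc 0 T) (Scale.low A σ n) R₀,
              ∀ G₁ ∈ pathBall (Set.Icc 0 T) (Scale A σ) R₀,
              ∀ G₂ ∈ pathBall (Set.Icc 0 T) (Scale A (σ + ε)) R₁,
                (∀ t, ‖V t - lowPath n U t‖ ≤ η) →
                Rc (pathOfReal V, pathOfReal G₁, pathOfReal G₂)
                  = pathOfReal (R (V, G₁, G₂))) := by
  obtain ⟨c₀, hc₀, hF⟩ := hF
  obtain ⟨δ, c, hδ, hcc, hFc⟩ : ∃ δ c : ℝ, 0 < δ ∧ c₀ ≤ c ∧ (HolomorphicAssumption R₀ F →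
      ∃ Fc : Cplx (Scale A σ) → Cplx (Scale A (σ + ε)),
        (∀ u : Scale A σ, ‖u‖ ≤ 4 * R₀ → Fc (Cplx.ofReal u) = Cplx.ofReal (F u)) ∧
        HolomorphicUpToBoundary Fc (cylinder (Scale A σ) (4 * R₀) (2 * δ)) ∧
        ∀ u ∈ cylinder (Scale A σ) (4 * R₀) (2 * δ),
          ∀ v ∈ cylinder (Scale A σ) (4 * R₀) (2 * δ),
            ‖Fc u‖ ≤ c ∧ ‖Fc u - Fc v‖ ≤ c * ‖u - v‖) := by
    by_cases h : HolomorphicAssumption R₀ F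
    · obtain ⟨δ, Fc, c₁, hδ, -, h1, h2, h3⟩ := h
      refine ⟨δ, max c₀ c₁, hδ, le_max_left _ _, fun _ => ⟨Fc, h1, h2, fun u hu v hv => ?_⟩⟩
      have h4 := h3 u hu v hv
      exact ⟨h4.1.trans (le_max_right _ _), h4.2.trans
        (mul_le_mul_of_nonneg_right (le_max_right _ _) (norm_nonneg _))⟩
    · exact ⟨1, c₀, one_pos, le_rfl, fun h' => absurd h' h⟩
  have hc : 0 < c := hc₀.trans_le hcc
  have hF' : ∀ u v : Scale A σ, ‖u‖ ≤ 4 * R₀ → ‖v‖ ≤ 4 * R₀ →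
      ‖F u‖ ≤ c ∧ ‖F u - F v‖ ≤ c * ‖u - v‖ := fun u v hu hv =>
    ⟨(hF u v hu hv).1.trans hcc, (hF u v hu hv).2.trans
      (mul_le_mul_of_nonneg_right hcc (norm_nonneg _))⟩
  obtain ⟨B, hB⟩ := exists_norm_highPath_le hA hK hT hε C hobs hcomm R₀ (c + R₁)
  obtain ⟨Λ, B', hop⟩ := exists_reconstruction_operators hA hK hT hε C hobs.1
  have hlim := Scale.tendsto_freqWeight_neg hε
  have ev : ∀ a b : ℝ, 0 < b → ∀ᶠ n : ℕ in Filter.atTop, freqWeight (-ε) n * a < b := by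
    intro a b hb
    have h1 := hlim.mul_const a
    rw [zero_mul] at h1
    exact h1.eventually_lt_const hb
  -- In turn: smallness of Q_nU for unobserved solutions, contraction, and the bounds on M G used
  -- for the real and the imaginary part.
  obtain ⟨n, hn1, hn2, hn3, hn4⟩ := ((ev B (R₀ / 8) (by positivity)).and
    ((ev (16 * c * B') 1 one_pos).and ((ev (B' * (c + R₁)) (R₀ / 8) (by positivity)).and
      (ev (B' * (c + R₁)) (δ / 2) (by positivity))))).exists
  obtain ⟨L, M, hL, hM, hLM⟩ := hop n
  have := Scale.completeSpace hK σ
  have : CompleteSpace (Scale.high A σ n) := (isClosed_high σ n).completeSpace_coe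
  obtain ⟨R, hRmaps, ⟨K, hRlip⟩, hRsol, hRc⟩ := exists_reconstruction_map
    (I := Set.Icc 0 T) (Scale.low A σ n).subtypeL (fun v => le_rfl) (Scale.high A σ n).subtypeL
    (fun v => le_rfl) L M hR₀ hR₁ hc hδ hL hM (by linarith) (by linarith) (by linarith) F
    (fun u v hu hv => (hF' u v hu hv).2)
  have hsplit : ∀ (U : C(Set.Icc 0 T, Scale A σ)) t,
      (Scale.low A σ n).subtypeL (lowPath n U t) + (Scale.high A σ n).subtypeL (highPath n U t)
        = U t := fun U t => Scale.lowProj_add_highProj (U t)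
  refine ⟨n, R, fun p _ => hRmaps p, ⟨K, hRlip.lipschitzOnWith⟩, ?_, ?_⟩
  · intro U hU H₁ hH₁ H₂ hH₂ hsol
    obtain ⟨G, hG, -, hmild⟩ :=
      hsol.exists_source hA hT.le hε hR₀.le hR₁.le hc.le hF' hU hH₁ hH₂
    refine hRsol _ _ _ _ G (fun t => (Scale.norm_highProj_le _).trans (hU t)) ?_ ?_
      (hLM U G hmild hsol.2)
    · intro t
      rw [hsplit]
      exact (norm_add_le _ _).trans (by linarith [hU t, hH₁ t])
    · intro t
      rw [hsplit]
      exact hG t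
  · intro hhol
    obtain ⟨Fc, hFc1, hFc2, hFc3⟩ := hFc hhol
    obtain ⟨η, hη, hRc⟩ := hRc Fc hFc1 hFc2 hFc3
    refine ⟨η, δ, hη, hδ, fun U hU H₁ hH₁ H₂ hH₂ hsol => ?_⟩
    obtain ⟨G, -, hGn, hmild⟩ :=
      hsol.exists_source hA hT.le hε hR₀.le hR₁.le hc.le hF' hU hH₁ hH₂
    have hlow : lowPath n U ∈ pathBall (Set.Icc 0 T) (Scale.low A σ n) R₀ := fun t =>
      (Scale.norm_lowProj_le _).trans (hU t)
    -- Only here does the extra regularity of U enter: L P_nU = Q_nU - M G is a difference of two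
    -- terms of size at most R₀/8.
    have hLV : ‖L (lowPath n U)‖ ≤ R₀ / 4 := by
      have h1 : L (lowPath n U) = highPath n U - M G := by
        rw [hLM U G hmild hsol.2, add_sub_cancel_right]
      have h2 : ‖highPath n U‖ ≤ R₀ / 8 := (ContinuousMap.norm_le _ (by positivity)).2 fun t =>
        (hB U G hU hGn hmild hsol.2 n t).trans hn1.le
      have h3 : ‖M G‖ ≤ B' * freqWeight (-ε) n * (c + R₁) := M.le_of_opNorm_le_of_le hM hGn
      rw [h1]
      exact (norm_sub_le _ _).trans (by linarith)
    obtain ⟨Rc, h1, h2, h3⟩ := hRc _ hlow hLV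
    exact ⟨Rc, h1, h2, fun V _ G₁ hG₁ G₂ hG₂ hV => h3 V G₁ hG₁ G₂ hG₂ hV⟩
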